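/- Let $k\ge 1$ be an integer. For graphs $G$ and $H$, the Gallai--Ramsey number $gr_k(G:H)$ is the minimum integer $n$ such that every coloring of the edges of the complete graph $K_n$ using at most $k$ colors contains a rainbow copy of $G$ (a subgraph isomorphic to $G$ no two edges of which have the same color) or a monochromatic copy of $H$ (a subgraph isomorphic to $H$ all of whose edges have the same color). Then $$gr_k(K_3:C_8)=3k+5,$$ where $K_3$ is the triangle and $C_8$ is the cycle on $8$ vertices. Moreover, for every integer $n\ge 3k+5$, every coloring of the edges of $K_n$ using at most $k$ colors contains a rainbow triangle or a monochromatic $8$-cycle, whereas for every nonnegative integer $n<3k+5$ there is a coloring of the edges of $K_n$ using at most $k$ colors that contains neither. -/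

import Mathlib

namespace GallaiRamsey

variable {V W K : Type*}

/-- The edge-coloured complete graph on `V` with colouring `c` contains a rainbow copy of `G`: a (not
necessarily induced) copy of `G`, no two distinct edges of which have the same colour. -/
def HasRainbowCopy (c : SimpleGraph.TopEdgeLabeling V K) (G : SimpleGraph W) : Prop :=
  ∃ f : SimpleGraph.Copy G (⊤ : SimpleGraph V),
    Function.Injective fun e : G.edgeSet => c (f.mapEdgeSet e)

/-- The edge-coloured complete graph on `V` with colouring `c` contains a monochromatic copy of `H`: a
(not necessarily induced) copy of `H`, all edges of which have one and the same colour. -/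
def HasMonochromaticCopy (c : SimpleGraph.TopEdgeLabeling V K) (H : SimpleGraph W) : Prop :=
  ∃ (f : SimpleGraph.Copy H (⊤ : SimpleGraph V)) (i : K),
    ∀ e : H.edgeSet, c (f.mapEdgeSet e) = i

/-- Every colouring of the edges of `K_n` with at most `k` colours (an arbitrary, not necessarily
surjective, map to a set of `k` colours) contains a rainbow copy of `G` or a monochromatic copy
of `H`. -/
def Forces {W₁ W₂ : Type*} (k : ℕ) (G : SimpleGraph W₁) (H : SimpleGraph W₂) (n : ℕ) : Prop :=
  ∀ c : SimpleGraph.TopEdgeLabeling (Fin n) (Fin k),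
    HasRainbowCopy c G ∨ HasMonochromaticCopy c H

/-- `N` is the Gallai–Ramsey number `gr_k(G : H)`: the minimum `n` such that every colouring of the
edges of `K_n` with at most `k` colours contains a rainbow copy of `G` or a monochromatic copy of
`H`. -/
def IsGallaiRamseyNumber {W₁ W₂ : Type*} (k : ℕ) (G : SimpleGraph W₁) (H : SimpleGraph W₂)
    (N : ℕ) : Prop :=
  IsLeast {n : ℕ | Forces k G H n} N

end GallaiRamsey

/-!
The colouring that shows `gr_k(K₃ : C₈) > 3k + 4` colours the seven first vertices in colour `0`
and gives each further colour to all pairs whose larger end lies in its own group of three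
vertices. It has no rainbow triangle, and a monochromatic `C₈` would need eight vertices in colour
`0`, or a vertex cover of `C₈` by three vertices in another colour.

For the upper bound, take a colouring of at least `3k + 5` vertices without rainbow triangle and
without monochromatic `C₈`. Consider the sets `A` of vertices equipped with sets `X j`, one for
each colour `j`, of at most three vertices sending colour `j` to all of `A`, such that
`|A| + ∑ j, |X j| ≥ 3k + 5` (`Cone`). If `A` has a proper module (a subset whose vertices are
not distinguished by the other vertices of `A`) with at least four vertices, one can pass to it
(`Cone.restrict`): the lost vertices join the sets `X j`, and none of these can grow to four
vertices, since `K_{4,4}` contains `C₈`. The case `|A| = 5` is impossible, since then each `X j` has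
three vertices and closes up a monochromatic path of three vertices in `A`. In the remaining case,
Gallai's theorem (`IsGallai.exists_not_spanning`) provides two colours `r`, `b` such that
the other colours do not connect `A`. The components of these other colours are modules, hence of
size at most three. So `A ∪ X r ∪ X b`, which has at least eleven vertices, becomes a complete
multipartite graph with parts of size at most three, the edges between two parts having one and the
same colour, `r` or `b` (`Cone.isBlowup`). A monochromatic `C₈` in it can be turned into one of the
original colouring (`Cone.false_of_octagon`).

This reduces the upper bound to a statement about eleven vertices, `IsBlowup.not_noOctagon`: a
two-coloured complete multipartite graph of this kind contains a monochromatic `C₈`. A part of size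
three is treated directly (`IsBlowup.false_of_triple`). For a part of size two, colour its pair in
the majority colour of its neighbours; by induction there is a monochromatic `C₈`, and if it uses
the new edge, one ends up with a path of eight vertices between twins (`TwinPath.false_of_card`).
If all parts are singletons, the statement is that the Ramsey number of `C₈` versus `C₈` is at most
`11` (`not_noMono_eight`). Here a monochromatic `C₇` leads to a `C₈`, while without monochromatic
`C₇` a Hamiltonian cycle composed of a red and a blue path leads to a hexagon and a path on the
remaining five vertices in opposite colours (`not_noMono_seven_of_noMono_eight`).
-/

namespace GallaiRamsey

/-! ### Cycles in a relation -/

/-- The relation `R` contains a cycle of length `m`: pairwise distinct points `f 0, …, f (m - 1)`,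
each related to the cyclically next one. -/
def HasCycle {V : Type*} (m : ℕ) [NeZero m] (R : V → V → Prop) : Prop :=
  ∃ f : Fin m → V, Function.Injective f ∧ ∀ i, R (f i) (f (i + 1))

theorem HasCycle.comap {V W : Type*} {m : ℕ} [NeZero m] {R : V → V → Prop} {g : W → V}
    (hg : Function.Injective g) (h : HasCycle m fun x y => R (g x) (g y)) : HasCycle m R := by
  obtain ⟨f, hf, hR⟩ := h
  exact ⟨g ∘ f, hg.comp hf, hR⟩

theorem HasCycle.of_seven {V : Type*} {R : V → V → Prop} (a b c d e f g : V)
    (hnd : [a, b, c, d, e, f, g].Nodup) (h1 : R a b) (h2 : R b c) (h3 : R c d) (h4 : R d e)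
    (h5 : R e f) (h6 : R f g) (h7 : R g a) : HasCycle 7 R := by
  refine ⟨![a, b, c, d, e, f, g], List.nodup_ofFn.1 (by simpa using hnd), ?_⟩
  intro i
  fin_cases i <;> assumption

theorem HasCycle.of_eight {V : Type*} {R : V → V → Prop} (a b c d e f g h : V)
    (hnd : [a, b, c, d, e, f, g, h].Nodup) (h1 : R a b) (h2 : R b c) (h3 : R c d) (h4 : R d e)
    (h5 : R e f) (h6 : R f g) (h7 : R g h) (h8 : R h a) : HasCycle 8 R := by
  refine ⟨![a, b, c, d, e, f, g, h], List.nodup_ofFn.1 (by simpa using hnd), ?_⟩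
  intro i
  fin_cases i <;> assumption

theorem HasCycle.of_nine {V : Type*} {R : V → V → Prop} (a b c d e f g h i : V)
    (hnd : [a, b, c, d, e, f, g, h, i].Nodup) (h1 : R a b) (h2 : R b c) (h3 : R c d) (h4 : R d e)
    (h5 : R e f) (h6 : R f g) (h7 : R g h) (h8 : R h i) (h9 : R i a) : HasCycle 9 R := by
  refine ⟨![a, b, c, d, e, f, g, h, i], List.nodup_ofFn.1 (by simpa using hnd), ?_⟩
  intro i
  fin_cases i <;> assumption

/-- An injective tuple of elements of a finite type extends to an injective enumeration. -/
theorem exists_injective_extension {m n : ℕ} (h : m ≤ n) (f : Fin m → Fin n)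
    (hf : Function.Injective f) :
    ∃ g : Fin n → Fin n, Function.Injective g ∧ ∀ i, g (Fin.castLE h i) = f i := by
  classical
  let s : Finset (Fin n) := Finset.univ.image (Fin.castLE h)
  let f' : Fin n → Fin n := fun x => if hx : x.val < m then f ⟨x, hx⟩ else x
  obtain ⟨g, hg⟩ := Finset.exists_equiv_extend_of_card_eq (α := Fin n) (β := Fin n)
    (t := Finset.univ) (s := s) (f := f') (by simp) (by simp) (by
      intro x hx y hy hxy
      simp only [s, Finset.coe_image, Finset.coe_univ, Set.image_univ, Set.mem_range] at hx hy
      obtain ⟨i, rfl⟩ := hx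
      obtain ⟨j, rfl⟩ := hy
      simp only [f', Fin.val_castLE, Fin.is_lt, dite_true, Fin.eta] at hxy
      rw [hf hxy])
  refine ⟨fun x => g x, fun x y hxy => g.injective (Subtype.ext hxy), fun i => ?_⟩
  refine (hg _ (by simp [s])).trans ?_
  simp [f']

/-! ### Two-colourings of `K₁₁` without monochromatic `C₇` -/

/-- A two-colouring of the pairs of `Fin 11` (`true` is called red, `false` blue) without a
monochromatic cycle of length `m`. -/
def NoMono (m : ℕ) [NeZero m] (c : Fin 11 → Fin 11 → Bool) : Prop :=
  ∀ ε, ¬ HasCycle m fun x y => c x y = ε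

theorem NoMono.comap {m : ℕ} [NeZero m] {c : Fin 11 → Fin 11 → Bool} (h : NoMono m c)
    {g : Fin 11 → Fin 11} (hg : Function.Injective g) : NoMono m fun x y => c (g x) (g y) :=
  fun ε hc => h ε (hc.comap hg)

theorem NoMono.not {m : ℕ} [NeZero m] {c : Fin 11 → Fin 11 → Bool} (h : NoMono m c) :
    NoMono m fun x y => !c x y := by
  intro ε hc
  refine h (!ε) ?_
  obtain ⟨f, hf, hR⟩ := hc
  exact ⟨f, hf, fun i => by rw [← hR i, Bool.not_not]⟩

/-- A red hexagon `0, …, 5` and a blue path `6, …, 10` force a monochromatic `C₇` or `C₈`.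

Without red `C₇`, no vertex of the path has two consecutive red neighbours on the hexagon, so
without red `C₈` any two vertices of the path have a common blue neighbour on the hexagon. Inserting
such neighbours into the path, at an edge and between the two ends, gives a blue `C₇` unless these
neighbours are all the same vertex `b`. Then the colours from the path to the vertex after `b` have
to alternate along the closed path of length five. -/
theorem false_of_hexagon_of_path {c : Fin 11 → Fin 11 → Bool} (hs : ∀ x y, c x y = c y x)
    (n7 : NoMono 7 c) (n8 : NoMono 8 c) (z : Fin 6 → Fin 11) (hz : z = ![0, 1, 2, 3, 4, 5])
    (w : Fin 5 → Fin 11) (hw : w = ![6, 7, 8, 9, 10])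
    (hc : ∀ i, c (z i) (z (i + 1)) = true) (p0 : c 6 7 = false) (p1 : c 7 8 = false)
    (p2 : c 8 9 = false) (p3 : c 9 10 = false) : False := by
  have nc : ∀ i j, c (w j) (z i) = true → c (w j) (z (i + 1)) = false := by
    intro i j h
    refine Bool.eq_false_of_not_eq_true fun h' => n7 true ?_
    have hi : i + 1 + 1 + 1 + 1 + 1 + 1 = i := by clear * -; revert i; decide
    refine .of_seven (w j) (z (i + 1)) (z (i + 1 + 1)) (z (i + 1 + 1 + 1)) (z (i + 1 + 1 + 1 + 1))
      (z (i + 1 + 1 + 1 + 1 + 1)) (z (i + 1 + 1 + 1 + 1 + 1 + 1))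
      (by subst hz hw; clear h h' hi; revert i j; decide)
      h' (hc _) (hc _) (hc _) (hc _) (hc _) (by rw [hi, hs]; exact h)
  have z0 : z 0 = 0 := by rw [hz]; rfl
  have z1 : z 1 = 1 := by rw [hz]; rfl
  have z2 : z 2 = 2 := by rw [hz]; rfl
  have z3 : z 3 = 3 := by rw [hz]; rfl
  have z4 : z 4 = 4 := by rw [hz]; rfl
  have z5 : z 5 = 5 := by rw [hz]; rfl
  have interleave : ∀ i j, i ≠ j → c (w i) (z 0) = true → c (w i) (z 2) = true →
      c (w j) (z 1) = true → c (w j) (z 3) = true → False := by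
    intro i j hij h0 h2 h1 h3
    refine n8 true (.of_eight (z 0) (w i) (z 2) (z 1) (w j) (z 3) (z 4) (z 5)
      (by subst hz hw; clear h0 h1 h2 h3; revert i j; decide) ?_ h2 ?_ ?_ h3 (hc 3) (hc 4) (hc 5))
    · rw [hs]; exact h0
    · rw [hs]; exact hc 1
    · rw [hs]; exact h1
  have common : ∀ i j, i ≠ j → ∃ b, c (w i) (z b) = false ∧ c (w j) (z b) = false := by
    intro i j hij
    by_contra! hno
    have hno' : ∀ b, c (w i) (z b) = true ∨ c (w j) (z b) = true := by
      intro b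
      by_contra! h
      exact hno b (by simpa using h.1) (by simpa using h.2)
    have i0 := nc 0 i
    have i1 := nc 1 i
    have i2 := nc 2 i
    have j0 := nc 0 j
    have j1 := nc 1 j
    have j2 := nc 2 j
    have k0 := hno' 0
    have k1 := hno' 1
    have k2 := hno' 2
    have k3 := hno' 3
    have e1 := interleave i j hij
    have e2 := interleave j i hij.symm
    simp only [zero_add, show (1 : Fin 6) + 1 = 2 from rfl, show (2 : Fin 6) + 1 = 3 from rfl] at *
    grind
  have uniq : ∀ a b, c (w 0) (z b) = false → c (w 4) (z b) = false →
      (∃ j : Fin 4, c (w j.castSucc) (z a) = false ∧ c (w j.succ) (z a) = false) → a = b := by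
    rintro a b hb0 hb4 ⟨j, h1, h2⟩
    by_contra hab
    have hb0' : c (z b) (w 0) = false := by rw [hs]; exact hb0
    have q0 : c (w 0) (w 1) = false := by rw [hw]; exact p0
    have q1 : c (w 1) (w 2) = false := by rw [hw]; exact p1
    have q2 : c (w 2) (w 3) = false := by rw [hw]; exact p2
    have q3 : c (w 3) (w 4) = false := by rw [hw]; exact p3
    refine n7 false ?_
    have h2' : c (z a) (w j.succ) = false := by rw [hs]; exact h2
    fin_cases j
    · exact .of_seven (w 0) (z a) (w 1) (w 2) (w 3) (w 4) (z b)
        (by subst hz hw; clear * - hab; revert a b; decide) h1 h2' q1 q2 q3 hb4 hb0'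
    · exact .of_seven (w 0) (w 1) (z a) (w 2) (w 3) (w 4) (z b)
        (by subst hz hw; clear * - hab; revert a b; decide) q0 h1 h2' q2 q3 hb4 hb0'
    · exact .of_seven (w 0) (w 1) (w 2) (z a) (w 3) (w 4) (z b)
        (by subst hz hw; clear * - hab; revert a b; decide) q0 q1 h1 h2' q3 hb4 hb0'
    · exact .of_seven (w 0) (w 1) (w 2) (w 3) (z a) (w 4) (z b)
        (by subst hz hw; clear * - hab; revert a b; decide) q0 q1 q2 h1 h2' hb4 hb0'
  obtain ⟨b, hb0, hb4⟩ := common 0 4 (by decide)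
  obtain ⟨a, ha⟩ := common (Fin.castSucc (0 : Fin 4)) (Fin.succ 0) (by decide)
  have hab := uniq a b hb0 hb4 ⟨0, ha⟩
  subst hab
  have step : ∀ j : Fin 4, ∀ d, c (w j.castSucc) (z d) = false → c (w j.succ) (z d) = false →
      d = a := fun j d h1 h2 => uniq d a hb0 hb4 ⟨j, h1, h2⟩
  have close : ∀ d, c (w 0) (z d) = false → c (w 4) (z d) = false → d = a :=
    fun d h1 h2 => (uniq a d h1 h2 ⟨0, ha⟩).symm
  have ne1 : a + 1 ≠ a := by clear * -; revert a; decide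
  have ne2 : a + 1 + 1 ≠ a := by clear * -; revert a; decide
  have alt : ∀ j : Fin 4, c (w j.castSucc) (z (a + 1)) ≠ c (w j.succ) (z (a + 1)) := by
    intro j h
    cases h1 : c (w j.castSucc) (z (a + 1)) with
    | false => exact ne1 (step j _ h1 (h ▸ h1))
    | true => exact ne2 (step j _ (nc _ _ h1) (nc _ _ (h ▸ h1)))
  have alt' : c (w 0) (z (a + 1)) ≠ c (w 4) (z (a + 1)) := by
    intro h
    cases h1 : c (w 0) (z (a + 1)) with
    | false => exact ne1 (close _ h1 (h ▸ h1))
    | true => exact ne2 (close _ (nc _ _ h1) (nc _ _ (h ▸ h1)))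
  have a0 : c (w 0) (z (a + 1)) ≠ c (w 1) (z (a + 1)) := alt 0
  have a1 : c (w 1) (z (a + 1)) ≠ c (w 2) (z (a + 1)) := alt 1
  have a2 : c (w 2) (z (a + 1)) ≠ c (w 3) (z (a + 1)) := alt 2
  have a3 : c (w 3) (z (a + 1)) ≠ c (w 4) (z (a + 1)) := alt 3
  revert a0 a1 a2 a3 alt'
  generalize c (w 0) (z (a + 1)) = x0
  generalize c (w 1) (z (a + 1)) = x1
  generalize c (w 2) (z (a + 1)) = x2
  generalize c (w 3) (z (a + 1)) = x3
  generalize c (w 4) (z (a + 1)) = x4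
  clear * -
  cases x0 <;> cases x1 <;> cases x2 <;> cases x3 <;> cases x4 <;> simp

/-- In every two-colouring of the pairs of the elements of a nonempty list, some rearrangement of
the list is a red path followed by a blue path. A further element `w` is inserted next to the
turning point `x`: after it if `w x` is red, before it if `w x` is blue. -/
theorem exists_perm_red_blue {V : Type*} (c : V → V → Bool) (hs : ∀ x y, c x y = c y x)
    (v : V) (l : List V) :
    ∃ (l₁ : List V) (x : V) (l₂ : List V), (l₁ ++ x :: l₂).Perm (v :: l) ∧
      (l₁ ++ [x]).IsChain (fun a b => c a b = true) ∧
      (x :: l₂).IsChain (fun a b => c a b = false) := by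
  induction l with
  | nil => exact ⟨[], v, [], by simp⟩
  | cons w l ih =>
    obtain ⟨l₁, x, l₂, hp, h1, h2⟩ := ih
    have hp' : ∀ l' : List V, l'.Perm (w :: (l₁ ++ x :: l₂)) → l'.Perm (v :: w :: l) := fun l' h =>
      h.trans ((hp.cons w).trans (List.Perm.swap ..))
    cases hwx : c w x with
    | true =>
      have hxw : c x w = true := by rw [hs]; exact hwx
      cases l₂ with
      | nil =>
        refine ⟨l₁ ++ [x], w, [], hp' _ ?_, ?_, by simp⟩
        · exact List.perm_append_singleton w (l₁ ++ [x])
        · simp_all [List.isChain_append, List.isChain_cons]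
      | cons y l₂ =>
        cases hwy : c w y with
        | true =>
          refine ⟨l₁ ++ [x, w], y, l₂, hp' _ ?_, ?_, ?_⟩
          · have : l₁ ++ [x, w] ++ y :: l₂ = (l₁ ++ [x]) ++ w :: (y :: l₂) := by simp
            rw [this]
            refine List.perm_middle.trans ?_
            simp
          · simp_all [List.isChain_append, List.isChain_cons]
          · simp_all [List.isChain_cons]
        | false =>
          refine ⟨l₁ ++ [x], w, y :: l₂, hp' _ ?_, ?_, ?_⟩
          · refine List.perm_middle.trans ?_
            simp
          · simp_all [List.isChain_append, List.isChain_cons]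
          · simp_all [List.isChain_cons]
    | false =>
      rcases List.eq_nil_or_concat l₁ with rfl | ⟨l₁, u, rfl⟩
      · exact ⟨[], w, x :: l₂, hp' _ (by simp), by simp, by simp_all [List.isChain_cons]⟩
      · simp only [List.concat_eq_append] at *
        cases hwu : c w u with
        | true =>
          have huw : c u w = true := by rw [hs]; exact hwu
          refine ⟨l₁ ++ [u], w, x :: l₂, hp' _ List.perm_middle, ?_, ?_⟩
          · simp_all [List.isChain_append, List.isChain_cons]
          · simp_all [List.isChain_cons]
        | false =>
          have huw : c u w = false := by rw [hs]; exact hwu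
          refine ⟨l₁, u, w :: x :: l₂, hp' _ ?_, ?_, ?_⟩
          · have : l₁ ++ u :: w :: x :: l₂ = (l₁ ++ [u]) ++ w :: (x :: l₂) := by simp
            rw [this]
            exact List.perm_middle
          · simp_all [List.isChain_append, List.isChain_cons]
          · simp_all [List.isChain_cons]

/-- Every two-colouring of `K₁₁` has a Hamiltonian cycle consisting of a red path with `t` edges and
a blue path. -/
theorem exists_hamiltonian_red_blue (c : Fin 11 → Fin 11 → Bool) (hs : ∀ x y, c x y = c y x) :
    ∃ (v : Fin 11 → Fin 11) (t : ℕ), Function.Injective v ∧ t ≤ 11 ∧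
      ∀ i : Fin 11, c (v i) (v (i + 1)) = decide (i.val < t) := by
  obtain ⟨l₁, x, l₂, hp, h1, h2⟩ := exists_perm_red_blue c hs 0 ((List.finRange 11).tail)
  have hp' : (l₁ ++ x :: l₂).Perm (List.finRange 11) := hp
  set l := l₁ ++ x :: l₂ with hl
  have hlen : l.length = 11 := by simpa using hp'.length_eq
  have hlen' : l₁.length + l₂.length + 1 = 11 := by
    simp only [hl, List.length_append, List.length_cons] at hlen; omega
  have hnd : l.Nodup := hp'.nodup_iff.2 (List.nodup_finRange 11)
  have hedge : ∀ (i : ℕ) (hi : i + 1 < l.length),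
      c (l[i]) (l[i + 1]) = decide (i < l₁.length) := by
    intro i hi
    by_cases hit : i < l₁.length
    · have := List.isChain_iff_getElem.1 h1 i (by simp; omega)
      simp only [hit, decide_true]
      rw [← this]
      congr 1
      · simp [hl, hit]
      · simp only [hl, List.getElem_append]
        split_ifs with h
        · rfl
        · have : i + 1 = l₁.length := by omega
          simp [this]
    · have := List.isChain_iff_getElem.1 h2 (i - l₁.length) (by simp; omega)
      simp only [hit, decide_false]
      rw [← this]
      congr 1
      · simp [hl, List.getElem_append, hit]
      · have : ¬ i + 1 < l₁.length := by omega
        have h' : i + 1 - l₁.length = i - l₁.length + 1 := by omega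
        simp [hl, List.getElem_append, this, h']
  let v : Fin 11 → Fin 11 := fun i => l[i.val]'(by omega)
  have hv : Function.Injective v := fun i j hij => Fin.ext <| by
    simpa using (hnd.getElem_inj_iff).1 hij
  have hvedge : ∀ i : Fin 11, i.val < 10 → c (v i) (v (i + 1)) = decide (i.val < l₁.length) := by
    intro i hi
    have h1 : (i + 1).val = i.val + 1 := by
      rw [Fin.val_add_one_of_lt']; omega
    have := hedge i.val (by omega)
    simp only [v, h1]
    exact this
  cases hclose : c (v 10) (v 0) with
  | false =>
    refine ⟨v, l₁.length, hv, by omega, fun i => ?_⟩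
    by_cases hi : i.val < 10
    · exact hvedge i hi
    · have : i = 10 := by ext; simp; omega
      subst this
      rw [show (10 : Fin 11) + 1 = 0 from rfl, hclose]
      simp; omega
  | true =>
    refine ⟨fun i => v (i - 1), l₁.length + 1, hv.comp (sub_left_injective), by omega, fun i => ?_⟩
    rcases eq_or_ne i 0 with rfl | hi
    · exact hclose
    · have hi' : i.val ≠ 0 := fun h => hi (Fin.ext h)
      have h1 : (i - 1).val = i.val - 1 := by
        rw [Fin.val_sub_one_of_ne_zero hi]
      have := hvedge (i - 1) (by omega)
      rw [sub_add_cancel] at this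
      simp only [add_sub_cancel_right]
      rw [this, h1, decide_eq_decide]
      omega

/-- `false_of_hexagon_of_path` for arbitrary vertices, with the colours possibly exchanged. -/
theorem false_of_hexagon_of_path' {c : Fin 11 → Fin 11 → Bool} (hs : ∀ x y, c x y = c y x)
    (n7 : NoMono 7 c) (n8 : NoMono 8 c) (ε : Bool) (a0 a1 a2 a3 a4 a5 b0 b1 b2 b3 b4 : Fin 11)
    (hnd : [a0, a1, a2, a3, a4, a5, b0, b1, b2, b3, b4].Nodup)
    (h0 : c a0 a1 = ε) (h1 : c a1 a2 = ε) (h2 : c a2 a3 = ε) (h3 : c a3 a4 = ε) (h4 : c a4 a5 = ε)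
    (h5 : c a5 a0 = ε) (k0 : c b0 b1 = !ε) (k1 : c b1 b2 = !ε) (k2 : c b2 b3 = !ε)
    (k3 : c b3 b4 = !ε) : False := by
  have hv : Function.Injective ![a0, a1, a2, a3, a4, a5, b0, b1, b2, b3, b4] :=
    List.nodup_ofFn.1 (by simpa using hnd)
  cases ε with
  | true =>
    refine false_of_hexagon_of_path (fun x y => hs _ _) (n7.comap hv) (n8.comap hv) _ rfl _ rfl ?_
      k0 k1 k2 k3
    intro i
    fin_cases i <;> assumption
  | false =>
    refine false_of_hexagon_of_path (fun x y => congrArg _ (hs _ _)) (n7.comap hv).not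
      (n8.comap hv).not _ rfl _ rfl ?_ (congrArg _ k0) (congrArg _ k1) (congrArg _ k2)
      (congrArg _ k3)
    intro i
    refine congrArg Bool.not (?_ : _ = false)
    fin_cases i <;> assumption

/-- A Hamiltonian cycle `0, 1, …, 10` whose first `t ≥ 6` edges are red and whose other edges are
blue yields a monochromatic `C₇` or `C₈`: chords of the red path closing one of these cycles have to
be blue, and then there is a hexagon of one colour whose complement contains a path of the other. -/
theorem false_of_hamiltonian {c : Fin 11 → Fin 11 → Bool} (hs : ∀ x y, c x y = c y x)
    (n7 : NoMono 7 c) (n8 : NoMono 8 c) (t : ℕ) (ht : 6 ≤ t) (ht' : t ≤ 11)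
    (he : ∀ i : Fin 11, c i (i + 1) = decide (i.val < t)) : False := by
  have hs' : ∀ {x y ε}, c x y = ε → c y x = ε := fun h => (hs _ _).trans h
  have e0 : c 0 1 = true := (he 0).trans (decide_eq_true (by simp; omega))
  have e1 : c 1 2 = true := (he 1).trans (decide_eq_true (by simp; omega))
  have e2 : c 2 3 = true := (he 2).trans (decide_eq_true (by simp; omega))
  have e3 : c 3 4 = true := (he 3).trans (decide_eq_true (by simp; omega))
  have e4 : c 4 5 = true := (he 4).trans (decide_eq_true (by simp; omega))
  have e5 : c 5 6 = true := (he 5).trans (decide_eq_true (by simp; omega))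
  have e6 : c 6 7 = decide (6 < t) := he 6
  have e7 : c 7 8 = decide (7 < t) := he 7
  have e8 : c 8 9 = decide (8 < t) := he 8
  have e9 : c 9 10 = decide (9 < t) := he 9
  have e10 : c 10 0 = decide (10 < t) := he 10
  have f06 : c 0 6 = false := Bool.eq_false_of_not_eq_true fun h =>
    n7 true (.of_seven 0 1 2 3 4 5 6 (by decide) e0 e1 e2 e3 e4 e5 (hs' h))
  obtain rfl | ht := ht.eq_or_lt
  · simp only [lt_self_iff_false, decide_false, Nat.reduceLT] at *
    exact false_of_hexagon_of_path' hs n7 n8 false 0 6 7 8 9 10 1 2 3 4 5 (by decide)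
      f06 e6 e7 e8 e9 e10 e1 e2 e3 e4
  simp only [ht, decide_true] at e6
  have f07 : c 0 7 = false := Bool.eq_false_of_not_eq_true fun h =>
    n8 true (.of_eight 0 1 2 3 4 5 6 7 (by decide) e0 e1 e2 e3 e4 e5 e6 (hs' h))
  have f17 : c 1 7 = false := Bool.eq_false_of_not_eq_true fun h =>
    n7 true (.of_seven 1 2 3 4 5 6 7 (by decide) e1 e2 e3 e4 e5 e6 (hs' h))
  obtain rfl | ht := (Nat.succ_le_of_lt ht).eq_or_lt
  · simp only [Nat.succ_eq_add_one, Nat.reduceAdd, lt_self_iff_false, decide_false,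
      Nat.reduceLT] at *
    have f16 : c 1 6 = true := Bool.eq_true_of_not_eq_false fun h =>
      n7 false (.of_seven 1 7 8 9 10 0 6 (by decide) f17 e7 e8 e9 e10 f06 (hs' h))
    exact false_of_hexagon_of_path' hs n7 n8 true 1 2 3 4 5 6 7 8 9 10 0 (by decide)
      e1 e2 e3 e4 e5 (hs' f16) e7 e8 e9 e10
  have ht : 7 < t := ht
  simp only [ht, decide_true] at e7
  have f18 : c 1 8 = false := Bool.eq_false_of_not_eq_true fun h =>
    n8 true (.of_eight 1 2 3 4 5 6 7 8 (by decide) e1 e2 e3 e4 e5 e6 e7 (hs' h))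
  have f28 : c 2 8 = false := Bool.eq_false_of_not_eq_true fun h =>
    n7 true (.of_seven 2 3 4 5 6 7 8 (by decide) e2 e3 e4 e5 e6 e7 (hs' h))
  obtain rfl | ht := (Nat.succ_le_of_lt ht).eq_or_lt
  · simp only [Nat.succ_eq_add_one, Nat.reduceAdd, lt_self_iff_false, decide_false,
      Nat.reduceLT] at *
    exact false_of_hexagon_of_path' hs n7 n8 false 8 9 10 0 7 1 2 3 4 5 6 (by decide)
      e8 e9 e10 f07 (hs' f17) f18 e2 e3 e4 e5
  have ht : 8 < t := ht
  simp only [ht, decide_true] at e8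
  have f29 : c 2 9 = false := Bool.eq_false_of_not_eq_true fun h =>
    n8 true (.of_eight 2 3 4 5 6 7 8 9 (by decide) e2 e3 e4 e5 e6 e7 e8 (hs' h))
  have f39 : c 3 9 = false := Bool.eq_false_of_not_eq_true fun h =>
    n7 true (.of_seven 3 4 5 6 7 8 9 (by decide) e3 e4 e5 e6 e7 e8 (hs' h))
  obtain rfl | ht := (Nat.succ_le_of_lt ht).eq_or_lt
  · simp only [Nat.succ_eq_add_one, Nat.reduceAdd, lt_self_iff_false, decide_false,
      Nat.reduceLT] at *
    exact n7 false (.of_seven 9 10 0 7 1 8 2 (by decide) e9 e10 f07 (hs' f17) f18 (hs' f28) f29)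
  have ht : 9 < t := ht
  simp only [ht, decide_true] at e9
  have f3 : c 3 10 = false := Bool.eq_false_of_not_eq_true fun h =>
    n8 true (.of_eight 3 4 5 6 7 8 9 10 (by decide) e3 e4 e5 e6 e7 e8 e9 (hs' h))
  -- The blue chords now form the path `0, 7, 1, 8, 2, 9, 3, 10`, whose chords in turn are red.
  have f03 : c 0 3 = true := Bool.eq_true_of_not_eq_false fun h =>
    n7 false (.of_seven 0 7 1 8 2 9 3 (by decide) f07 (hs' f17) f18 (hs' f28) f29 (hs' f39) (hs' h))
  have f7 : c 7 10 = true := Bool.eq_true_of_not_eq_false fun h =>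
    n7 false (.of_seven 7 1 8 2 9 3 10 (by decide) (hs' f17) f18 (hs' f28) f29 (hs' f39) f3 (hs' h))
  have f10 : c 10 0 = true := Bool.eq_true_of_not_eq_false fun h =>
    n8 false (.of_eight 0 7 1 8 2 9 3 10 (by decide) f07 (hs' f17) f18 (hs' f28) f29 (hs' f39) f3 h)
  exact n7 true (.of_seven 0 3 4 5 6 7 10 (by decide) f03 e3 e4 e5 e6 f7 f10)

/-- Every two-colouring of `K₁₁` contains a monochromatic `C₇` or a monochromatic `C₈`. -/
theorem not_noMono_seven_of_noMono_eight {c : Fin 11 → Fin 11 → Bool}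
    (hs : ∀ x y, c x y = c y x) (n8 : NoMono 8 c) : ¬ NoMono 7 c := by
  intro n7
  obtain ⟨v, t, hv, ht, he⟩ := exists_hamiltonian_red_blue c hs
  by_cases h6 : 6 ≤ t
  · exact false_of_hamiltonian (fun x y => hs _ _) (n7.comap hv) (n8.comap hv) t h6 ht he
  · -- Traverse the cycle backwards and exchange the colours.
    have hv' : Function.Injective fun i => v (-i) := hv.comp neg_injective
    refine false_of_hamiltonian (fun x y => congrArg _ (hs _ _)) (n7.comap hv').not
      (n8.comap hv').not (11 - t) (by omega) (by omega) fun i => ?_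
    have h := he (-(i + 1))
    have h1 : -(i + 1) + 1 = -i := by clear * -; revert i; decide
    have h2 : (-(i + 1)).val = 10 - i.val := by clear * -; revert i; decide
    rw [h1, h2, hs] at h
    simp only [h]
    rw [← decide_not, decide_eq_decide]
    omega

/-! ### Two-colourings of `K₁₁` with a monochromatic `C₇` -/

/-- A red `C₉` without red `C₈` has only blue chords of length two; these form a blue `C₉`, so its
chords of length two, that is the chords of length four of the red one, are red. Together with the
edges these contain a `C₈`. -/
theorem NoMono.nine {c : Fin 11 → Fin 11 → Bool} (hs : ∀ x y, c x y = c y x) (n8 : NoMono 8 c) :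
    NoMono 9 c := by
  rintro ε ⟨f, hf, he⟩
  replace he : ∀ i j, j = i + 1 → c (f i) (f j) = ε := fun i j h => h ▸ he i
  have h2 : ∀ i j, j = i + 2 → c (f i) (f j) = !ε := by
    intro i j hj
    refine Bool.eq_not_of_ne fun h => n8 ε ?_
    subst hj
    refine .of_eight (f i) (f (i + 2)) (f (i + 3)) (f (i + 4)) (f (i + 5)) (f (i + 6)) (f (i + 7))
      (f (i + 8)) (List.Nodup.map (l := [i, i + 2, i + 3, i + 4, i + 5, i + 6, i + 7, i + 8]) hf ?_)
      h ?_ ?_ ?_ ?_ ?_ ?_ ?_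
    · clear * -; revert i; decide
    all_goals
      refine he _ _ ?_
      clear * -; revert i; decide
  have h4 : ∀ i j, j = i + 4 → c (f i) (f j) = ε := by
    intro i j hj
    refine Bool.not_eq_not.1 fun h => n8 (!ε) ?_
    subst hj
    refine .of_eight (f i) (f (i + 4)) (f (i + 6)) (f (i + 8)) (f (i + 1)) (f (i + 3)) (f (i + 5))
      (f (i + 7)) (List.Nodup.map (l := [i, i + 4, i + 6, i + 8, i + 1, i + 3, i + 5, i + 7]) hf ?_)
      ?_ ?_ ?_ ?_ ?_ ?_ ?_ ?_
    · clear * -; revert i; decide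
    · simpa using h
    all_goals
      refine h2 _ _ ?_
      clear * -; revert i; decide
  exact n8 ε (.of_eight (f 0) (f 8) (f 3) (f 7) (f 2) (f 6) (f 1) (f 5)
    (List.Nodup.map (l := [0, 8, 3, 7, 2, 6, 1, 5]) hf (by decide))
    ((hs _ _).trans (he 8 0 rfl)) (h4 8 3 rfl) (h4 3 7 rfl) (h4 7 2 rfl) (h4 2 6 rfl) (h4 6 1 rfl)
    (h4 1 5 rfl) (h4 5 0 rfl))

/-- The graph on `Fin 8` in which `0, …, 4` form a complete graph without the edge `02`, and the
independent vertices `5`, `6`, `7` are joined to all of `0, …, 4` except `x`, `y`, `z`. -/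
def InsertionAdj (x y z i j : Fin 8) : Prop :=
  (i < 5 ∧ j < 5 ∧ i ≠ j ∧ ¬ (i = 0 ∧ j = 2) ∧ ¬ (i = 2 ∧ j = 0)) ∨
    (i < 5 ∧ j = 5 ∧ i ≠ x) ∨ (i < 5 ∧ j = 6 ∧ i ≠ y) ∨ (i < 5 ∧ j = 7 ∧ i ≠ z) ∨
    (j < 5 ∧ i = 5 ∧ j ≠ x) ∨ (j < 5 ∧ i = 6 ∧ j ≠ y) ∨ (j < 5 ∧ i = 7 ∧ j ≠ z)

instance (x y z i j : Fin 8) : Decidable (InsertionAdj x y z i j) := by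
  unfold InsertionAdj; infer_instance

/-- Hamiltonian cycles obtained by inserting `5`, `6`, `7` at different places into `0, 1, 2, 3, 4`;
whatever the exceptions `x`, `y`, `z` are, one of these cycles avoids them. -/
def insertionCycles : List (Fin 8 → Fin 8) :=
  [![0, 5, 1, 6, 2, 7, 3, 4], ![0, 7, 1, 2, 5, 3, 6, 4], ![0, 6, 1, 2, 3, 5, 4, 7],
    ![0, 5, 1, 2, 3, 7, 4, 6], ![0, 6, 1, 7, 2, 5, 3, 4], ![0, 7, 1, 2, 3, 6, 4, 5],
    ![0, 1, 5, 2, 6, 3, 7, 4], ![0, 1, 2, 6, 3, 7, 4, 5], ![0, 5, 1, 6, 2, 3, 4, 7]]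

theorem hasCycle_insertionAdj :
    ∀ x < 5, ∀ y < 5, ∀ z < 5, ∃ f ∈ insertionCycles, Function.Injective f ∧
      ∀ i, InsertionAdj x y z (f i) (f (i + 1)) := by
  decide +kernel

/-- A red heptagon `0, …, 6` together with a vertex `7` that is joined in red to `0`, `2` and `4`
forces a monochromatic `C₈`: all pairs in `{5, 1, 6, 3, 7}` except `56` are blue, and each of the
three remaining vertices has at most one red neighbour in this set, so they can be inserted into a
blue pentagon. -/
theorem false_of_heptagon_of_three {c : Fin 11 → Fin 11 → Bool} (hs : ∀ x y, c x y = c y x)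
    (n8 : NoMono 8 c) (e0 : c 0 1 = true) (e1 : c 1 2 = true) (e2 : c 2 3 = true)
    (e3 : c 3 4 = true) (e4 : c 4 5 = true) (e5 : c 5 6 = true) (e6 : c 6 0 = true)
    (w0 : c 7 0 = true) (w2 : c 7 2 = true) (w4 : c 7 4 = true) : False := by
  have n9 := n8.nine hs
  have hs' : ∀ {x y ε}, c x y = ε → c y x = ε := fun h => (hs _ _).trans h
  have blue : ∀ {x y}, (c x y = true → HasCycle 8 fun x y => c x y = true) →
      c x y = false := fun h => Bool.eq_false_of_not_eq_true fun h' => n8 true (h h')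
  have f13 : c 1 3 = false := blue fun h => .of_eight 0 1 3 2 7 4 5 6 (by decide)
    e0 h (hs' e2) (hs' w2) w4 e4 e5 e6
  have f17 : c 1 7 = false := blue fun h => .of_eight 0 7 1 2 3 4 5 6 (by decide)
    (hs' w0) (hs' h) e1 e2 e3 e4 e5 e6
  have f37 : c 3 7 = false := blue fun h => .of_eight 0 1 2 3 7 4 5 6 (by decide)
    e0 e1 e2 h w4 e4 e5 e6
  have f57 : c 5 7 = false := blue fun h => .of_eight 0 1 2 3 4 7 5 6 (by decide)
    e0 e1 e2 e3 (hs' w4) (hs' h) e5 e6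
  have f67 : c 6 7 = false := blue fun h => .of_eight 0 1 2 3 4 5 6 7 (by decide)
    e0 e1 e2 e3 e4 e5 h w0
  have f15 : c 1 5 = false := blue fun h => .of_eight 0 7 4 3 2 1 5 6 (by decide)
    (hs' w0) w4 (hs' e3) (hs' e2) (hs' e1) h e5 e6
  have f16 : c 1 6 = false := blue fun h => .of_eight 6 1 0 7 2 3 4 5 (by decide)
    (hs' h) (hs' e0) (hs' w0) w2 e2 e3 e4 e5
  have f35 : c 3 5 = false := blue fun h => .of_eight 5 3 4 7 2 1 0 6 (by decide)
    (hs' h) e3 (hs' w4) w2 (hs' e1) (hs' e0) (hs' e6) (hs' e5)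
  have f36 : c 3 6 = false := blue fun h => .of_eight 4 7 0 1 2 3 6 5 (by decide)
    (hs' w4) w0 e0 e1 e2 h (hs' e5) (hs' e4)
  have key : ∀ x : Fin 11, 8 ≤ x → ∃ m : Fin 8, m < 5 ∧
      ∀ i : Fin 8, i < 5 → i ≠ m → c x (![5, 1, 6, 3, 7, 8, 9, 10] i) = false := by
    intro x hx
    have k56 : ¬ (c x 5 = true ∧ c x 6 = true) := fun h => n8 true <|
      .of_eight 5 x 6 0 1 2 3 4 (by clear * - hx; decide +revert) (hs' h.1) h.2 e6 e0 e1 e2 e3 e4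
    have k13 : ¬ (c x 1 = true ∧ c x 3 = true) := fun h => n9 true <|
      .of_nine 0 7 2 1 x 3 4 5 6 (by clear * - hx; decide +revert)
        (hs' w0) w2 (hs' e1) (hs' h.1) h.2 e3 e4 e5 e6
    have k17 : ¬ (c x 1 = true ∧ c x 7 = true) := fun h => n9 true <|
      .of_nine 0 7 x 1 2 3 4 5 6 (by clear * - hx; decide +revert)
        (hs' w0) (hs' h.2) h.1 e1 e2 e3 e4 e5 e6
    have k37 : ¬ (c x 3 = true ∧ c x 7 = true) := fun h => n9 true <|
      .of_nine 4 7 x 3 2 1 0 6 5 (by clear * - hx; decide +revert)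
        (hs' w4) (hs' h.2) h.1 (hs' e2) (hs' e1) (hs' e0) (hs' e6) (hs' e5) (hs' e4)
    have k16 : ¬ (c x 1 = true ∧ c x 6 = true) := fun h => n9 true <|
      .of_nine 0 7 2 3 4 5 6 x 1 (by clear * - hx; decide +revert)
        (hs' w0) w2 e2 e3 e4 e5 (hs' h.2) h.1 (hs' e0)
    have k35 : ¬ (c x 3 = true ∧ c x 5 = true) := fun h => n9 true <|
      .of_nine 4 7 2 1 0 6 5 x 3 (by clear * - hx; decide +revert)
        (hs' w4) w2 (hs' e1) (hs' e0) (hs' e6) (hs' e5) (hs' h.2) h.1 e3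
    have k15 : ¬ (c x 1 = true ∧ c x 5 = true) := fun h => n9 true <|
      .of_nine 6 5 x 1 2 3 4 7 0 (by clear * - hx; decide +revert)
        (hs' e5) (hs' h.2) h.1 e1 e2 e3 (hs' w4) w0 (hs' e6)
    have k36 : ¬ (c x 3 = true ∧ c x 6 = true) := fun h => n9 true <|
      .of_nine 5 6 x 3 2 1 0 7 4 (by clear * - hx; decide +revert)
        e5 (hs' h.2) h.1 (hs' e2) (hs' e1) (hs' e0) (hs' w0) w4 e4
    have k57 : ¬ (c x 5 = true ∧ c x 7 = true) := fun h => n8 true <|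
      .of_eight 7 x 5 4 3 2 1 0 (by clear * - hx; decide +revert)
        (hs' h.2) h.1 (hs' e4) (hs' e3) (hs' e2) (hs' e1) (hs' e0) (hs' w0)
    have k67 : ¬ (c x 6 = true ∧ c x 7 = true) := fun h => n8 true <|
      .of_eight 7 x 6 0 1 2 3 4 (by clear * - hx; decide +revert)
        (hs' h.2) h.1 e6 e0 e1 e2 e3 (hs' w4)
    have five : ∀ P : Fin 8 → Prop, P 0 → P 1 → P 2 → P 3 → P 4 → ∀ i < 5, P i := by
      intro P h0 h1 h2 h3 h4 i hi
      fin_cases i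
      · exact h0
      · exact h1
      · exact h2
      · exact h3
      · exact h4
      all_goals exact absurd hi (by decide)
    by_cases h5 : c x 5 = true
    · exact ⟨0, by decide, five _ (by simp) (by simp; grind) (by simp; grind) (by simp; grind)
        (by simp; grind)⟩
    by_cases h1 : c x 1 = true
    · exact ⟨1, by decide, five _ (by simp; grind) (by simp) (by simp; grind) (by simp; grind)
        (by simp; grind)⟩
    by_cases h6 : c x 6 = true
    · exact ⟨2, by decide, five _ (by simp; grind) (by simp; grind) (by simp) (by simp; grind)
        (by simp; grind)⟩
    by_cases h3 : c x 3 = true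
    · exact ⟨3, by decide, five _ (by simp; grind) (by simp; grind) (by simp; grind) (by simp)
        (by simp; grind)⟩
    · exact ⟨4, by decide, five _ (by simp; grind) (by simp; grind) (by simp; grind)
        (by simp; grind) (by simp)⟩
  obtain ⟨x, hx, hx'⟩ := key 8 (by decide)
  obtain ⟨y, hy, hy'⟩ := key 9 (by decide)
  obtain ⟨z, hz, hz'⟩ := key 10 (by decide)
  obtain ⟨f, -, hf, hadj⟩ := hasCycle_insertionAdj x hx y hy z hz
  refine n8 false (HasCycle.comap (g := ![5, 1, 6, 3, 7, 8, 9, 10]) (by decide)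
    ⟨f, hf, fun i => ?_⟩)
  have h := hadj i
  generalize f i = a at h
  generalize f (i + 1) = b at h
  have sym : ∀ {x y}, c x y = false → c y x = false := hs'
  rcases h with ⟨ha, hb, hab, h1, h2⟩ | ⟨ha, rfl, h⟩ | ⟨ha, rfl, h⟩ | ⟨ha, rfl, h⟩ |
    ⟨ha, rfl, h⟩ | ⟨ha, rfl, h⟩ | ⟨ha, rfl, h⟩
  · clear hadj key hx' hy' hz'
    fin_cases a <;> fin_cases b <;> first
      | exact absurd ha (by decide)
      | exact absurd hb (by decide)
      | exact absurd rfl hab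
      | exact absurd ⟨rfl, rfl⟩ h1
      | exact absurd ⟨rfl, rfl⟩ h2
      | assumption
      | exact hs' (by assumption)
  · exact hs' (hx' a ha h)
  · exact hs' (hy' a ha h)
  · exact hs' (hz' a ha h)
  · exact hx' b ha h
  · exact hy' b ha h
  · exact hz' b ha h

theorem exists_notMem_of_card_lt_seven {s : Finset (Fin 7)} (h : s.card < 7) : ∃ a, a ∉ s := by
  by_contra! hs
  rw [Finset.eq_univ_of_forall hs] at h
  simp at h

/-- Among four sets with at most two elements in a set of size seven, two have a union with at most
three elements. -/
theorem exists_card_union_le_three (I : Fin 4 → Finset (Fin 7)) (hI : ∀ j, (I j).card ≤ 2) :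
    ∃ i j, i ≠ j ∧ (I i ∪ I j).card ≤ 3 := by
  by_contra! h
  have key : ∀ i j, i ≠ j → Disjoint (I i) (I j) ∧ (I i).card = 2 := by
    intro i j hij
    have h1 := Finset.card_union_add_card_inter (I i) (I j)
    have h2 := h i j hij
    have h3 := hI i
    have h4 := hI j
    refine ⟨?_, by omega⟩
    rw [Finset.disjoint_iff_inter_eq_empty, ← Finset.card_eq_zero]
    omega
  have hcard : (Finset.univ.biUnion I).card = 8 := by
    rw [Finset.card_biUnion fun i _ j _ hij => (key i j hij).1]
    rw [Fin.sum_univ_four, (key 0 1 (by decide)).2, (key 1 0 (by decide)).2,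
      (key 2 0 (by decide)).2, (key 3 0 (by decide)).2]
  have := Finset.card_le_univ (Finset.univ.biUnion I)
  rw [hcard] at this
  simp at this

/-- **`R(C₈, C₈) ≤ 11`**: every two-colouring of `K₁₁` contains a monochromatic `C₈`.

By `not_noMono_seven_of_noMono_eight` there is a monochromatic, say red, heptagon. If one of the
four other vertices has three red neighbours on it, `false_of_heptagon_of_three` applies. Otherwise
each of them has at most two, any two of them have at least three common blue neighbours on the
heptagon, and two of them at least four; choosing distinct common neighbours one after the other
gives a blue `C₈`. -/
theorem not_noMono_eight {c : Fin 11 → Fin 11 → Bool} (hs : ∀ x y, c x y = c y x) :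
    ¬ NoMono 8 c := by
  intro n8
  -- It suffices to consider a red heptagon `0, …, 6`.
  suffices H : ∀ c : Fin 11 → Fin 11 → Bool, (∀ x y, c x y = c y x) → NoMono 8 c →
      ∀ z : Fin 7 → Fin 11, Function.Injective z → (∀ i, c (z i) (z (i + 1)) = true) → False by
    refine not_noMono_seven_of_noMono_eight hs n8 ?_
    rintro ε ⟨z, hz, he⟩
    cases ε with
    | true => exact H c hs n8 z hz he
    | false =>
      exact H (fun x y => !c x y) (fun x y => congrArg _ (hs x y)) n8.not z hz
        fun i => congrArg Bool.not (he i)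
  clear hs n8 c
  intro c hs n8 z hz he
  obtain ⟨v, hv, hvz⟩ := exists_injective_extension (by norm_num : 7 ≤ 11) z hz
  let w : Fin 4 → Fin 11 := fun j => v (Fin.natAdd 7 j)
  have hw : Function.Injective w := hv.comp (Fin.natAdd_injective 4 7)
  have hwz : ∀ j i, w j ≠ z i := by
    intro j i h
    rw [← hvz i] at h
    have := congrArg Fin.val (hv h)
    simp at this
    omega
  have nc : ∀ i j, c (w j) (z i) = true → c (w j) (z (i + 1)) = false := by
    intro i j h
    refine Bool.eq_false_of_not_eq_true fun h' => n8 true ?_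
    have hi : i + 1 + 1 + 1 + 1 + 1 + 1 + 1 = i := by clear * -; revert i; decide
    refine .of_eight (w j) (z (i + 1)) (z (i + 1 + 1)) (z (i + 1 + 1 + 1)) (z (i + 1 + 1 + 1 + 1))
      (z (i + 1 + 1 + 1 + 1 + 1)) (z (i + 1 + 1 + 1 + 1 + 1 + 1))
      (z (i + 1 + 1 + 1 + 1 + 1 + 1 + 1)) ?_
      h' (he _) (he _) (he _) (he _) (he _) (he _) (by rw [hi, hs]; exact h)
    refine List.nodup_cons.2 ⟨by simp [hwz], List.Nodup.map (l := [i + 1, i + 1 + 1, i + 1 + 1 + 1,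
      i + 1 + 1 + 1 + 1, i + 1 + 1 + 1 + 1 + 1, i + 1 + 1 + 1 + 1 + 1 + 1,
      i + 1 + 1 + 1 + 1 + 1 + 1 + 1]) hz ?_⟩
    clear * -; revert i; decide
  let I : Fin 4 → Finset (Fin 7) := fun j => Finset.univ.filter fun i => c (w j) (z i) = true
  have hI : ∀ j i, i ∉ I j → c (w j) (z i) = false := fun j i h => by simpa [I] using h
  by_cases hthree : ∃ j, 3 ≤ (I j).card
  · obtain ⟨j, hj⟩ := hthree
    have hcyc : ∀ J : Finset (Fin 7), (∀ i ∈ J, i + 1 ∉ J) → 3 ≤ J.card →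
        ∃ i, i ∈ J ∧ i + 2 ∈ J ∧ i + 4 ∈ J := by decide +kernel
    obtain ⟨i, h0, h2, h4⟩ := hcyc (I j) (fun i hi h => by
      have h1 := nc i j (by simpa [I] using hi)
      simp [I, h1] at h) hj
    simp only [I, Finset.mem_filter, Finset.mem_univ, true_and] at h0 h2 h4
    -- Rotate the heptagon and put `w j` at place `7`.
    obtain ⟨u, hu, huz⟩ := exists_injective_extension (by norm_num : 8 ≤ 11)
      (Fin.snoc (fun k : Fin 7 => z (i + k)) (w j) : Fin 8 → Fin 11) (by
        rw [Fin.snoc_injective_iff]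
        exact ⟨hz.comp (add_right_injective i), by rintro ⟨k, hk⟩; exact hwz _ _ hk.symm⟩)
    have uz : ∀ k : Fin 7, u (Fin.castLE (by norm_num) k) = z (i + k) := by
      intro k
      have := huz k.castSucc
      rwa [Fin.snoc_castSucc] at this
    have uw : u 7 = w j := huz (Fin.last 7)
    have u0 : u 0 = z i := by simpa using uz 0
    have u1 : u 1 = z (i + 1) := uz 1
    have u2 : u 2 = z (i + 1 + 1) := (uz 2).trans (by rw [add_assoc]; rfl)
    have u3 : u 3 = z (i + 1 + 1 + 1) := (uz 3).trans (by simp only [add_assoc]; rfl)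
    have u4 : u 4 = z (i + 1 + 1 + 1 + 1) := (uz 4).trans (by simp only [add_assoc]; rfl)
    have u5 : u 5 = z (i + 1 + 1 + 1 + 1 + 1) := (uz 5).trans (by simp only [add_assoc]; rfl)
    have u6 : u 6 = z (i + 1 + 1 + 1 + 1 + 1 + 1) := (uz 6).trans (by simp only [add_assoc]; rfl)
    have hi : i + 1 + 1 + 1 + 1 + 1 + 1 + 1 = i := by clear * -; revert i; decide
    refine false_of_heptagon_of_three (c := fun x y => c (u x) (u y)) (fun _ _ => hs _ _)
      (n8.comap hu) ?_ ?_ ?_ ?_ ?_ ?_ ?_ ?_ ?_ ?_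
    · simp only [u0, u1, he]
    · simp only [u1, u2, he]
    · simp only [u2, u3, he]
    · simp only [u3, u4, he]
    · simp only [u4, u5, he]
    · simp only [u5, u6, he]
    · have := he (i + 1 + 1 + 1 + 1 + 1 + 1)
      rw [hi] at this
      simp only [u6, u0, this]
    · simp only [uw, u0, h0]
    · exact (congrArg₂ c uw (uz 2)).trans h2
    · exact (congrArg₂ c uw (uz 4)).trans h4
  · push Not at hthree
    have hI2 : ∀ j, (I j).card ≤ 2 := fun j => Nat.le_of_lt_succ (hthree j)
    have hI4 : ∀ i j, (I i ∪ I j).card ≤ 4 := fun i j =>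
      (Finset.card_union_le _ _).trans (add_le_add (hI2 i) (hI2 j))
    obtain ⟨p, s, hps, hcard⟩ := exists_card_union_le_three I hI2
    obtain ⟨q, r, hqr⟩ : ∃ q r : Fin 4, [p, q, r, s].Nodup := by
      clear * - hps; revert p s; decide
    obtain ⟨a, ha⟩ := exists_notMem_of_card_lt_seven (s := I p ∪ I q)
      (by have := hI4 p q; omega)
    obtain ⟨b, hb⟩ := exists_notMem_of_card_lt_seven (s := insert a (I q ∪ I r))
      (by have := hI4 q r; have := Finset.card_insert_le a (I q ∪ I r); omega)
    obtain ⟨d, hd⟩ := exists_notMem_of_card_lt_seven (s := insert a (insert b (I r ∪ I s)))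
      (by
        have := hI4 r s
        have := Finset.card_insert_le b (I r ∪ I s)
        have := Finset.card_insert_le a (insert b (I r ∪ I s))
        omega)
    obtain ⟨e, he'⟩ := exists_notMem_of_card_lt_seven
      (s := insert a (insert b (insert d (I p ∪ I s))))
      (by
        have := Finset.card_insert_le d (I p ∪ I s)
        have := Finset.card_insert_le b (insert d (I p ∪ I s))
        have := Finset.card_insert_le a (insert b (insert d (I p ∪ I s)))
        omega)
    simp only [Finset.mem_insert, Finset.mem_union, not_or] at ha hb hd he'
    have hs' : ∀ {x y ε}, c x y = ε → c y x = ε := fun h => (hs _ _).trans h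
    refine n8 false (.of_eight (w p) (z a) (w q) (z b) (w r) (z d) (w s) (z e) ?_
      (hI _ _ ha.1) (hs' (hI _ _ ha.2)) (hI _ _ hb.2.1) (hs' (hI _ _ hb.2.2)) (hI _ _ hd.2.2.1)
      (hs' (hI _ _ hd.2.2.2)) (hI _ _ he'.2.2.2.2) (hs' (hI _ _ he'.2.2.2.1)))
    have hzw : ∀ i j, z i ≠ w j := fun i j => (hwz j i).symm
    simp only [List.nodup_cons, List.mem_cons, List.not_mem_nil, or_false, not_or,
      List.nodup_nil, not_false_eq_true, and_true] at hqr ⊢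
    simp only [hw.eq_iff, hz.eq_iff, hwz, hzw, not_false_eq_true, and_true, true_and]
    grind

/-! ### Colourings with uncoloured twins -/

/-- A partial two-colouring of the pairs of `Fin 11`, `none` standing for an uncoloured pair, in
which being equal or uncoloured is an equivalence relation with classes of size at most three whose
members are twins. In other words, a complete multipartite graph with parts of size at most three,
coloured so that all edges between two parts have the same colour. -/
structure IsBlowup (col : Fin 11 → Fin 11 → Option Bool) : Prop where
  symm : ∀ x y, col x y = col y x
  diag : ∀ x, col x x = none
  twin : ∀ {x y}, col x y = none → ∀ z, col x z = col y z
  small : ∀ {x y z w}, [x, y, z, w].Nodup → col x y = none → col x z = none → col x w = none → False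

/-- There is no monochromatic `C₈`. -/
def NoOctagon (col : Fin 11 → Fin 11 → Option Bool) : Prop :=
  ∀ ε, ¬ HasCycle 8 fun x y => col x y = some ε

/-- If the classes of an equivalence relation on `Fin n` have at most three elements, then `Fin n`
can be rearranged so that elements at distance at least three are inequivalent: list it class by
class. -/
theorem exists_perm_not_rel {n : ℕ} (s : Setoid (Fin n))
    (h : ∀ x y z w, [x, y, z, w].Nodup → s.r x y → s.r x z → s.r x w → False) :
    ∃ σ : Equiv.Perm (Fin n), ∀ i j : Fin n, i.val + 3 ≤ j.val → ¬ s.r (σ i) (σ j) := by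
  let f : Fin n → Fin n := fun x => (Quotient.mk s x).out
  have hf : ∀ x y, f x = f y ↔ s.r x y := by
    intro x y
    constructor
    · intro hxy
      have : Quotient.mk s x = Quotient.mk s y := by
        rw [← Quotient.out_eq (Quotient.mk s x), ← Quotient.out_eq (Quotient.mk s y)]
        exact congrArg _ hxy
      exact Quotient.exact this
    · intro hxy
      have : Quotient.mk s x = Quotient.mk s y := Quotient.sound hxy
      simp only [f, this]
  refine ⟨Tuple.sort f, fun i j hij hr => ?_⟩
  have hmono := Tuple.monotone_sort f
  have hfij := (hf _ _).2 hr
  have between : ∀ k : Fin n, i ≤ k → k ≤ j → s.r (Tuple.sort f i) (Tuple.sort f k) := by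
    intro k hik hkj
    refine (hf _ _).1 (le_antisymm (hmono hik) ?_)
    rw [hfij]
    exact hmono hkj
  have hj := j.isLt
  refine h (Tuple.sort f i) (Tuple.sort f ⟨i.val + 1, by omega⟩)
    (Tuple.sort f ⟨i.val + 2, by omega⟩) (Tuple.sort f j) ?_
    (between _ (Fin.mk_le_mk.2 (by simp)) (Fin.mk_le_mk.2 (by omega)))
    (between _ (Fin.mk_le_mk.2 (by simp)) (Fin.mk_le_mk.2 (by omega))) hr
  refine List.Nodup.map (l := [i, ⟨i.val + 1, by omega⟩, ⟨i.val + 2, by omega⟩, j])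
    (Tuple.sort f).injective ?_
  simp [Fin.ext_iff]
  omega

theorem eq_none_or_eq_some_of_ne {o : Option Bool} {ε : Bool} (h : o ≠ some (!ε)) :
    o = none ∨ o = some ε := by
  revert o ε
  decide

section Triple

variable {col : Fin 11 → Fin 11 → Option Bool}

theorem IsBlowup.ne_none (h : IsBlowup col) {m x y : Fin 11} {ε : Bool}
    (hx : col m x = some ε) (hy : col m y = some (!ε)) : col x y ≠ none := by
  intro hxy
  have := h.twin hxy m
  rw [h.symm x, h.symm y, hx, hy] at this
  cases ε <;> simp at this

/-- Two neighbours `r`, `r'` of the twins `m₁, m₂, m₃` in colour `ε` cannot be joined in colour `ε`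
through a further vertex `a` if the twins have two more neighbours `p`, `q` in colour `ε`:
`m₁ r a r' m₂ p m₃ q` would be a `C₈`. -/
theorem IsBlowup.false_of_path (h : IsBlowup col) (n8 : NoOctagon col) {m₁ m₂ m₃ : Fin 11}
    (hm : [m₁, m₂, m₃].Nodup) (h12 : col m₁ m₂ = none) (h13 : col m₁ m₃ = none) {ε : Bool}
    {r a r' : Fin 11} (hr : col m₁ r = some ε) (hr' : col m₁ r' = some ε) (ha : col m₁ a ≠ none)
    (hne : r ≠ r') (hra : col r a = some ε) (har : col a r' = some ε)
    (hcard : 2 ≤ ((Finset.univ.filter fun x => col m₁ x = some ε) \ {r, a, r'}).card) : False := by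
  obtain ⟨p, hp, q, hq, hpq⟩ := Finset.one_lt_card.1 hcard
  simp only [Finset.mem_sdiff, Finset.mem_filter, Finset.mem_univ, true_and, Finset.mem_insert,
    Finset.mem_singleton, not_or] at hp hq
  have t2 := h.twin h12
  have t3 := h.twin h13
  have hs := h.symm
  have hd := h.diag
  refine n8 ε (.of_eight m₁ r a r' m₂ p m₃ q ?_ hr hra har (by rw [hs, ← t2, hr'])
    (by rw [← t2, hp.1]) (by rw [hs, ← t3, hp.1]) (by rw [← t3, hq.1]) (by rw [hs, hq.1]))
  have hd1 := hd m₁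
  have hdr := hd r
  have hda := hd a
  simp only [List.nodup_cons, List.mem_cons, List.not_mem_nil, or_false, not_or,
      List.nodup_nil, not_false_eq_true, and_true] at hm ⊢
  clear t2 t3 hs hd hcard n8 h
  and_intros <;> rintro rfl <;> simp_all

/-- There are no three pairwise uncoloured vertices, stated with `ε` the colour of at least half of
the eight edges from such a vertex. -/
theorem IsBlowup.false_of_triple_aux (h : IsBlowup col) (n8 : NoOctagon col) {m₁ m₂ m₃ : Fin 11}
    (hm : [m₁, m₂, m₃].Nodup) (h12 : col m₁ m₂ = none) (h13 : col m₁ m₃ = none) {ε : Bool}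
    (R B : Finset (Fin 11)) (hRdef : R = Finset.univ.filter fun x => col m₁ x = some ε)
    (hBdef : B = Finset.univ.filter fun x => col m₁ x = some (!ε))
    (hRB : R.card + B.card = 8) (hR4 : 4 ≤ R.card) : False := by
  have hs := h.symm
  have hs' : ∀ {x y o}, col x y = o → col y x = o := fun h => (hs _ _).trans h
  have memR : ∀ {x}, x ∈ R ↔ col m₁ x = some ε := by simp [hRdef]
  have memB : ∀ {x}, x ∈ B ↔ col m₁ x = some (!ε) := by simp [hBdef]
  have hRBne : ∀ {b r}, b ∈ B → r ∈ R → col b r ≠ none := fun hb hr h0 =>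
    h.ne_none (memR.1 hr) (memB.1 hb) (hs' h0)
  -- A vertex of `B` has at most one neighbour in `R` in colour `ε`.
  have atMost : ∀ {b r r'}, b ∈ B → r ∈ R → r' ∈ R → r ≠ r' →
      col b r = some (!ε) ∨ col b r' = some (!ε) := by
    intro b r r' hb hr hr' hne
    have h1 := hRBne hb hr
    have h2 := hRBne hb hr'
    by_contra! hcon
    have h1' := (eq_none_or_eq_some_of_ne hcon.1).resolve_left h1
    have h2' := (eq_none_or_eq_some_of_ne hcon.2).resolve_left h2
    refine h.false_of_path n8 hm h12 h13 (memR.1 hr) (memR.1 hr') (a := b)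
      (by rw [memB.1 hb]; simp) hne (hs' h1') h2' ?_
    rw [← hRdef]
    have hbR : b ∉ R := by rw [memR, memB.1 hb]; cases ε <;> simp
    have : R \ {r, b, r'} = R \ {r, r'} := by
      ext x
      simp only [Finset.mem_sdiff, Finset.mem_insert, Finset.mem_singleton]
      grind
    rw [this]
    have := Finset.le_card_sdiff {r, r'} R
    have := Finset.card_le_two (a := r) (b := r')
    omega
  obtain hR4 | hR5 := hR4.eq_or_lt
  · -- Both sides have size four: two vertices of `B` have a common neighbour in `R` in colour `!ε`.
    obtain ⟨b, hb, b', hb', hbb⟩ := Finset.one_lt_card.1 (by omega : 1 < B.card)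
    let T : Finset (Fin 11) := R.filter fun r => col b r ≠ some (!ε)
    let T' : Finset (Fin 11) := R.filter fun r => col b' r ≠ some (!ε)
    have hT : T.card ≤ 1 := by
      refine Finset.card_le_one.2 fun x hx y hy => by_contra fun hxy => ?_
      simp only [T, Finset.mem_filter] at hx hy
      rcases atMost hb hx.1 hy.1 hxy with h | h
      · exact hx.2 h
      · exact hy.2 h
    have hT' : T'.card ≤ 1 := by
      refine Finset.card_le_one.2 fun x hx y hy => by_contra fun hxy => ?_
      simp only [T', Finset.mem_filter] at hx hy
      rcases atMost hb' hx.1 hy.1 hxy with h | h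
      · exact hx.2 h
      · exact hy.2 h
    have : 0 < (R \ (T ∪ T')).card := by
      have := Finset.le_card_sdiff (T ∪ T') R
      have := Finset.card_union_le T T'
      omega
    obtain ⟨r, hr⟩ := Finset.card_pos.1 this
    simp only [T, T', Finset.mem_sdiff, Finset.mem_union, Finset.mem_filter, not_or, not_and,
      not_not] at hr
    refine h.false_of_path n8 hm h12 h13 (memB.1 hb) (memB.1 hb') (a := r)
      (by rw [memR.1 hr.1]; simp) hbb (hr.2.1 hr.1) (hs' (hr.2.2 hr.1)) ?_
    rw [← hBdef]
    have hrB : r ∉ B := by rw [memB, memR.1 hr.1]; cases ε <;> simp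
    have : B \ {b, r, b'} = B \ {b, b'} := by
      ext x
      simp only [Finset.mem_sdiff, Finset.mem_insert, Finset.mem_singleton]
      grind
    rw [this]
    have := Finset.le_card_sdiff {b, b'} B
    have := Finset.card_le_two (a := b) (b := b')
    omega
  -- Within `R`, not being joined in colour `!ε` is an equivalence relation with small classes.
  have noPath : ∀ {x y z}, x ∈ R → y ∈ R → z ∈ R → x ≠ z → col x y = some ε →
      col y z = some ε → False := by
    intro x y z hx hy hz hne hxy hyz
    refine h.false_of_path n8 hm h12 h13 (memR.1 hx) (memR.1 hz) (a := y)
      (by rw [memR.1 hy]; simp) hne hxy hyz ?_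
    rw [← hRdef]
    have := Finset.le_card_sdiff {x, y, z} R
    have := Finset.card_le_three (a := x) (b := y) (c := z)
    omega
  have trans : ∀ {x y z}, x ∈ R → y ∈ R → z ∈ R → col x y ≠ some (!ε) → col y z ≠ some (!ε) →
      x = z ∨ col x z ≠ some (!ε) := by
    intro x y z hx hy hz hxy hyz
    by_cases hxz : x = z
    · exact .inl hxz
    refine .inr ?_
    rcases eq_none_or_eq_some_of_ne hxy with h1 | h1
    · rwa [h.twin h1]
    · rcases eq_none_or_eq_some_of_ne hyz with h2 | h2
      · rwa [hs, ← h.twin h2, hs]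
      · exact (noPath hx hy hz hxz h1 h2).elim
  let S : Setoid (Fin R.card) :=
    { r := fun i j => i = j ∨ col (R.equivFin.symm i) (R.equivFin.symm j) ≠ some (!ε)
      iseqv := by
        refine ⟨fun i => .inl rfl, ?_, ?_⟩
        · rintro i j (rfl | hij)
          · exact .inl rfl
          · exact .inr (by rwa [hs])
        · rintro i j k (rfl | hij) (rfl | hjk)
          · exact .inl rfl
          · exact .inr hjk
          · exact .inr hij
          · rcases trans (R.equivFin.symm i).2 (R.equivFin.symm j).2 (R.equivFin.symm k).2 hij hjk
              with h | h
            · exact .inl (R.equivFin.symm.injective (Subtype.ext h))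
            · exact .inr h }
  have noRed : ∀ {x y z}, x ∈ R → y ∈ R → z ∈ R → x ≠ z → y ≠ z → col x y = some ε →
      col x z ≠ some (!ε) → False := by
    intro x y z hx hy hz hxz hyz hxy h2
    rcases eq_none_or_eq_some_of_ne h2 with h2 | h2
    · refine noPath hx hy hz hxz hxy ?_
      rwa [hs, ← h.twin h2]
    · exact noPath hy hx hz hyz (hs' hxy) h2
  obtain ⟨σ, hσ⟩ := exists_perm_not_rel S (by
    intro x y z w hnd hxy hxz hxw
    have hnd' : [(R.equivFin.symm x : Fin 11), R.equivFin.symm y, R.equivFin.symm z,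
        R.equivFin.symm w].Nodup :=
      List.Nodup.map (l := [x, y, z, w]) (Subtype.val_injective.comp R.equivFin.symm.injective) hnd
    have hnd0 := hnd'
    simp only [List.nodup_cons, List.mem_cons, List.not_mem_nil, or_false, not_or,
      List.nodup_nil, not_false_eq_true, and_true] at hnd hnd'
    have mx := (R.equivFin.symm x).2
    have my := (R.equivFin.symm y).2
    have mz := (R.equivFin.symm z).2
    have mw := (R.equivFin.symm w).2
    have hxy := hxy.resolve_left hnd.1.1
    have hxz := hxz.resolve_left hnd.1.2.1
    have hxw := hxw.resolve_left hnd.1.2.2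
    rcases eq_none_or_eq_some_of_ne hxy with h1 | h1
    · rcases eq_none_or_eq_some_of_ne hxz with h2 | h2
      · rcases eq_none_or_eq_some_of_ne hxw with h3 | h3
        · exact h.small hnd0 h1 h2 h3
        · exact noRed mx mw my hnd'.1.1 (Ne.symm hnd'.2.1.2) h3 hxy
      · exact noRed mx mz my hnd'.1.1 (Ne.symm hnd'.2.1.1) h2 hxy
    · exact noRed mx my mz hnd'.1.2.1 hnd'.2.1.1 h1 hxz)
  obtain ⟨e, he, heR, hfar⟩ : ∃ e : Fin R.card → Fin 11, Function.Injective e ∧ (∀ i, e i ∈ R) ∧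
      ∀ i j : Fin R.card, i.val + 3 ≤ j.val ∨ j.val + 3 ≤ i.val → col (e i) (e j) = some (!ε) := by
    refine ⟨fun i => R.equivFin.symm (σ i),
      Subtype.val_injective.comp (R.equivFin.symm.injective.comp σ.injective),
      fun i => (R.equivFin.symm (σ i)).2, ?_⟩
    have key : ∀ i j : Fin R.card, i.val + 3 ≤ j.val →
        col (R.equivFin.symm (σ i)) (R.equivFin.symm (σ j)) = some (!ε) := by
      intro i j hij
      by_contra hc
      exact hσ i j hij (.inr hc)
    rintro i j (hij | hij)
    · exact key i j hij
    · exact hs' (key j i hij)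
  -- Now `R` can be replaced by the image of `e`; there are four possible sizes.
  have hm1 : ∀ {b}, b ∈ B → col m₁ b = some (!ε) := fun hb => memB.1 hb
  have hm2 : ∀ {b}, b ∈ B → col m₂ b = some (!ε) := fun hb => by rw [← h.twin h12, memB.1 hb]
  have neBR : ∀ {b i}, b ∈ B → b ≠ e i := by
    rintro b i hb rfl
    have h1 := memB.1 hb
    rw [memR.1 (heR i)] at h1
    cases ε <;> simp at h1
  have neM1R : ∀ {i}, m₁ ≠ e i := by
    intro i hi
    have h1 := memR.1 (heR i)
    rw [← hi, h.diag] at h1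
    simp at h1
  have neM2R : ∀ {i}, m₂ ≠ e i := by
    intro i hi
    have h1 := memR.1 (heR i)
    rw [← hi, h12] at h1
    simp at h1
  have neM1B : ∀ {b}, b ∈ B → m₁ ≠ b := by
    rintro b hb rfl
    have h1 := memB.1 hb
    rw [h.diag] at h1
    simp at h1
  have neM2B : ∀ {b}, b ∈ B → m₂ ≠ b := by
    rintro b hb rfl
    have h1 := memB.1 hb
    rw [h12] at h1
    simp at h1
  have hm12 : m₁ ≠ m₂ := by simp at hm; tauto
  have pairing : ∀ {b b' i j}, b ∈ B → b' ∈ B → i ≠ j →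
      (col b (e i) = some (!ε) ∧ col b' (e j) = some (!ε)) ∨
      (col b (e j) = some (!ε) ∧ col b' (e i) = some (!ε)) ∨
      (col b (e i) ≠ some (!ε) ∧ col b' (e i) ≠ some (!ε)) ∨
      (col b (e j) ≠ some (!ε) ∧ col b' (e j) ≠ some (!ε)) := by
    intro b b' i j hb hb' hij
    have h1 := atMost hb (heR i) (heR j) (he.ne hij)
    have h2 := atMost hb' (heR i) (heR j) (he.ne hij)
    tauto
  have pairing' : ∀ {b b' i j k}, b ∈ B → b' ∈ B → i ≠ j → k ≠ i → k ≠ j →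
      col b (e k) ≠ some (!ε) → col b' (e k) ≠ some (!ε) →
      (col b (e i) = some (!ε) ∧ col b' (e j) = some (!ε)) := by
    intro b b' i j k hb hb' hij hki hkj h1 h2
    have h3 := atMost hb (heR k) (heR i) (he.ne hki)
    have h4 := atMost hb' (heR k) (heR j) (he.ne hkj)
    tauto
  clear hσ S noRed trans noPath hRBne
  generalize hn : R.card = n at *
  have hn8 : n ≤ 8 := by omega
  interval_cases n
  · -- `|R| = 5`, `|B| = 3`
    obtain ⟨b₁, b₂, b₃, h12', h13', h23', hBeq⟩ := Finset.card_eq_three.1 (by omega : B.card = 3)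
    have hb1 : b₁ ∈ B := by rw [hBeq]; simp
    have hb2 : b₂ ∈ B := by rw [hBeq]; simp
    have hb3 : b₃ ∈ B := by rw [hBeq]; simp
    have fin : ∀ b b' i j k, b ∈ B → b' ∈ B → b ≠ b' → b ≠ b₃ → b' ≠ b₃ → [i, j, k].Nodup →
        col (e i) (e j) = some (!ε) → col (e j) (e k) = some (!ε) →
        col b (e i) = some (!ε) → col b' (e k) = some (!ε) → False := by
      intro b b' i j k hb hb' hbb hb3' hb3'' hnd hij hjk hbi hbk
      refine n8 (!ε) (.of_eight b (e i) (e j) (e k) b' m₁ b₃ m₂ ?_ hbi hij hjk (hs' hbk)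
        (hs' (hm1 hb')) (hm1 hb3) (hs' (hm2 hb3)) (hm2 hb))
      have := List.Nodup.map (l := [i, j, k]) he hnd
      simp only [List.map_cons, List.map_nil, List.nodup_cons, List.mem_cons, List.not_mem_nil,
        or_false, not_or, List.nodup_nil, not_false_eq_true, and_true] at this ⊢
      grind
    rcases pairing (i := 3) (j := 4) hb1 hb2 (by decide) with hp | hp | hp | hp
    · exact fin b₁ b₂ 3 0 4 hb1 hb2 h12' h13' h23' (by decide) (hfar _ _ (by decide))
        (hfar _ _ (by decide)) hp.1 hp.2
    · exact fin b₁ b₂ 4 0 3 hb1 hb2 h12' h13' h23' (by decide) (hfar _ _ (by decide))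
        (hfar _ _ (by decide)) hp.1 hp.2
    · have hp' := pairing' (i := 0) (j := 1) hb1 hb2 (by decide) (by decide) (by decide) hp.1 hp.2
      exact fin b₁ b₂ 0 4 1 hb1 hb2 h12' h13' h23' (by decide) (hfar _ _ (by decide))
        (hfar _ _ (by decide)) hp'.1 hp'.2
    · have hp' := pairing' (i := 0) (j := 1) hb1 hb2 (by decide) (by decide) (by decide) hp.1 hp.2
      exact fin b₁ b₂ 0 4 1 hb1 hb2 h12' h13' h23' (by decide) (hfar _ _ (by decide))
        (hfar _ _ (by decide)) hp'.1 hp'.2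
  · -- `|R| = 6`, `|B| = 2`
    obtain ⟨b₁, b₂, h12', hBeq⟩ := Finset.card_eq_two.1 (by omega : B.card = 2)
    have hb1 : b₁ ∈ B := by rw [hBeq]; simp
    have hb2 : b₂ ∈ B := by rw [hBeq]; simp
    have fin : ∀ b b' i j k l m, b ∈ B → b' ∈ B → b ≠ b' → [i, j, k, l, m].Nodup →
        col (e i) (e j) = some (!ε) → col (e j) (e k) = some (!ε) →
        col (e k) (e l) = some (!ε) → col (e l) (e m) = some (!ε) →
        col b (e i) = some (!ε) → col b' (e m) = some (!ε) → False := by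
      intro b b' i j k l m hb hb' hbb hnd hij hjk hkl hlm hbi hbm
      refine n8 (!ε) (.of_eight b (e i) (e j) (e k) (e l) (e m) b' m₁ ?_ hbi hij hjk hkl hlm
        (hs' hbm) (hs' (hm1 hb')) (hm1 hb))
      have := List.Nodup.map (l := [i, j, k, l, m]) he hnd
      simp only [List.map_cons, List.map_nil, List.nodup_cons, List.mem_cons, List.not_mem_nil,
        or_false, not_or, List.nodup_nil, not_false_eq_true, and_true] at this ⊢
      grind
    rcases pairing (i := 3) (j := 5) hb1 hb2 (by decide) with hp | hp | hp | hp
    · exact fin b₁ b₂ 3 0 4 1 5 hb1 hb2 h12' (by decide) (hfar _ _ (by decide))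
        (hfar _ _ (by decide)) (hfar _ _ (by decide)) (hfar _ _ (by decide)) hp.1 hp.2
    · exact fin b₂ b₁ 3 0 4 1 5 hb2 hb1 h12'.symm (by decide) (hfar _ _ (by decide))
        (hfar _ _ (by decide)) (hfar _ _ (by decide)) (hfar _ _ (by decide)) hp.2 hp.1
    · have hp' := pairing' (i := 0) (j := 2) hb1 hb2 (by decide) (by decide) (by decide) hp.1 hp.2
      exact fin b₁ b₂ 0 4 1 5 2 hb1 hb2 h12' (by decide) (hfar _ _ (by decide))
        (hfar _ _ (by decide)) (hfar _ _ (by decide)) (hfar _ _ (by decide)) hp'.1 hp'.2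
    · have hp' := pairing' (i := 0) (j := 2) hb1 hb2 (by decide) (by decide) (by decide) hp.1 hp.2
      exact fin b₁ b₂ 0 4 1 5 2 hb1 hb2 h12' (by decide) (hfar _ _ (by decide))
        (hfar _ _ (by decide)) (hfar _ _ (by decide)) (hfar _ _ (by decide)) hp'.1 hp'.2
  · -- `|R| = 7`, `|B| = 1`
    obtain ⟨b, hBeq⟩ := Finset.card_eq_one.1 (by omega : B.card = 1)
    have hb : b ∈ B := by rw [hBeq]; simp
    obtain ⟨k, hk⟩ : ∃ k, ∀ i, i ≠ k → col b (e i) = some (!ε) := by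
      by_cases hex : ∃ k, col b (e k) ≠ some (!ε)
      · obtain ⟨k, hk⟩ := hex
        exact ⟨k, fun i hi => (atMost hb (heR i) (heR k) (he.ne hi)).resolve_right hk⟩
      · push Not at hex
        exact ⟨0, fun i _ => hex i⟩
    refine n8 (!ε) (.of_eight b (e (k + 4)) (e k) (e (k + 3)) (e (k + 6)) (e (k + 2)) (e (k + 5))
      (e (k + 1)) ?_ (hk _ ?_) (hfar _ _ ?_) (hfar _ _ ?_) (hfar _ _ ?_) (hfar _ _ ?_)
      (hfar _ _ ?_) (hfar _ _ ?_) (hs' (hk _ ?_)))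
    · refine List.nodup_cons.2 ⟨by simp [neBR hb], List.Nodup.map
        (l := [k + 4, k, k + 3, k + 6, k + 2, k + 5, k + 1]) he ?_⟩
      clear * -; revert k; decide
    all_goals clear * -; revert k; decide
  · -- `|R| = 8`
    exact n8 (!ε) (.of_eight (e 0) (e 3) (e 6) (e 1) (e 4) (e 7) (e 2) (e 5)
      (List.Nodup.map (l := [0, 3, 6, 1, 4, 7, 2, 5]) he (by decide))
      (hfar _ _ (by decide)) (hfar _ _ (by decide)) (hfar _ _ (by decide)) (hfar _ _ (by decide))
      (hfar _ _ (by decide)) (hfar _ _ (by decide)) (hfar _ _ (by decide)) (hfar _ _ (by decide)))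

end Triple

variable {col : Fin 11 → Fin 11 → Option Bool}

theorem card_fibers_add (g : Fin 11 → Option Bool) (ε : Bool) :
    (Finset.univ.filter fun x => g x = none).card +
      ((Finset.univ.filter fun x => g x = some ε).card +
        (Finset.univ.filter fun x => g x = some (!ε)).card) = 11 := by
  have h := Finset.card_eq_sum_card_fiberwise (f := g) (s := Finset.univ) (t := Finset.univ)
    (by simp)
  rw [Fintype.sum_option, Fintype.sum_bool] at h
  simp only [Finset.card_univ, Fintype.card_fin] at h
  cases ε <;> simp only [Bool.not_true, Bool.not_false] <;> omega

theorem IsBlowup.false_of_triple (h : IsBlowup col) (n8 : NoOctagon col) {m₁ m₂ m₃ : Fin 11}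
    (hm : [m₁, m₂, m₃].Nodup) (h12 : col m₁ m₂ = none) (h13 : col m₁ m₃ = none) : False := by
  have hN : (Finset.univ.filter fun x => col m₁ x = none).card = 3 := by
    have : (Finset.univ.filter fun x => col m₁ x = none) = {m₁, m₂, m₃} := by
      ext x
      simp only [Finset.mem_filter, Finset.mem_univ, true_and, Finset.mem_insert,
        Finset.mem_singleton]
      constructor
      · intro hx
        by_contra! hne
        refine h.small (x := m₁) (y := m₂) (z := m₃) (w := x) ?_ h12 h13 hx
        simp only [List.nodup_cons, List.mem_cons, List.not_mem_nil, or_false, not_or,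
          List.nodup_nil, not_false_eq_true, and_true] at hm ⊢
        exact ⟨⟨hm.1.1, hm.1.2, hne.1.symm⟩, ⟨hm.2, hne.2.1.symm⟩, hne.2.2.symm⟩
      · rintro (rfl | rfl | rfl)
        · exact h.diag _
        · exact h12
        · exact h13
    rw [this, Finset.card_eq_three]
    simp only [List.nodup_cons, List.mem_cons, List.not_mem_nil, or_false, not_or,
      List.nodup_nil, not_false_eq_true, and_true] at hm
    exact ⟨m₁, m₂, m₃, hm.1.1, hm.1.2, hm.2, rfl⟩
  have hsum := card_fibers_add (col m₁) true
  rw [hN] at hsum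
  by_cases h4 : 4 ≤ (Finset.univ.filter fun x => col m₁ x = some true).card
  · exact h.false_of_triple_aux n8 hm h12 h13 _ _ rfl rfl (by omega) h4
  · exact h.false_of_triple_aux (ε := false) n8 hm h12 h13 _ _ rfl rfl
      (by simp only [Bool.not_true, Bool.not_false] at *; omega)
      (by simp only [Bool.not_true] at *; omega)

/-- A partial colouring with uncoloured twins `0` and `7` in which `0, 1, …, 7` is a path in the
colour `ε`, and in which there are no three pairwise uncoloured vertices and no monochromatic `C₈`.
In the comments on its lemmas, `ε` is red and the other colour is blue. -/
structure TwinPath (col : Fin 11 → Fin 11 → Option Bool) (ε : Bool) : Prop where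
  blowup : IsBlowup col
  noOctagon : NoOctagon col
  noTriple : ∀ {x y z}, [x, y, z].Nodup → col x y = none → col x z = none → False
  twins : col 0 7 = none
  e0 : col 0 1 = some ε
  e1 : col 1 2 = some ε
  e2 : col 2 3 = some ε
  e3 : col 3 4 = some ε
  e4 : col 4 5 = some ε
  e5 : col 5 6 = some ε
  e6 : col 6 7 = some ε

namespace TwinPath

variable {ε : Bool}

theorem symm' (T : TwinPath col ε) {x y o} (h : col x y = o) : col y x = o :=
  (T.blowup.symm _ _).trans h

theorem seven (T : TwinPath col ε) {x o} (h : col 0 x = o) : col 7 x = o :=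
  (T.blowup.twin T.twins x).symm.trans h

theorem comap (T : TwinPath col ε) {g : Fin 11 → Fin 11} (hg : Function.Injective g)
    (h : (∀ i : Fin 11, i < 8 → g i = i) ∨
      g = ![7, 6, 5, 4, 3, 2, 1, 0, 8, 9, 10]) :
    TwinPath (fun x y => col (g x) (g y)) ε where
  blowup :=
    { symm := fun _ _ => T.blowup.symm _ _
      diag := fun _ => T.blowup.diag _
      twin := fun h _ => T.blowup.twin h _
      small := fun hnd => T.blowup.small (List.Nodup.map hg hnd) }
  noOctagon := fun δ hc => T.noOctagon δ (hc.comap hg)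
  noTriple := fun hnd => T.noTriple (List.Nodup.map hg hnd)
  twins := by
    rcases h with h | rfl
    · rw [h 0 (by decide), h 7 (by decide)]; exact T.twins
    · exact T.symm' T.twins
  e0 := by
    rcases h with h | rfl
    · rw [h 0 (by decide), h 1 (by decide)]; exact T.e0
    · exact T.symm' T.e6
  e1 := by
    rcases h with h | rfl
    · rw [h 1 (by decide), h 2 (by decide)]; exact T.e1
    · exact T.symm' T.e5
  e2 := by
    rcases h with h | rfl
    · rw [h 2 (by decide), h 3 (by decide)]; exact T.e2
    · exact T.symm' T.e4
  e3 := by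
    rcases h with h | rfl
    · rw [h 3 (by decide), h 4 (by decide)]; exact T.e3
    · exact T.symm' T.e3
  e4 := by
    rcases h with h | rfl
    · rw [h 4 (by decide), h 5 (by decide)]; exact T.e4
    · exact T.symm' T.e2
  e5 := by
    rcases h with h | rfl
    · rw [h 5 (by decide), h 6 (by decide)]; exact T.e5
    · exact T.symm' T.e1
  e6 := by
    rcases h with h | rfl
    · rw [h 6 (by decide), h 7 (by decide)]; exact T.e6
    · exact T.symm' T.e0

theorem six (T : TwinPath col ε) : col 0 6 = some ε :=
  (T.blowup.twin T.twins 6).trans (T.symm' T.e6)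

theorem colored (T : TwinPath col ε) {x : Fin 11} (h0 : x ≠ 0) (h7 : x ≠ 7) :
    col 0 x = some ε ∨ col 0 x = some (!ε) := by
  by_cases h : col 0 x = some (!ε)
  · exact .inr h
  rcases eq_none_or_eq_some_of_ne h with h | h
  · refine (T.noTriple ?_ T.twins h).elim
    simp [h0.symm, h7.symm]
  · exact .inl h

/-- The vertex `7` cannot be inserted into the red heptagon `0, …, 6`. -/
theorem not_consecutive (T : TwinPath col ε) :
    col 0 2 = some (!ε) ∧ col 0 5 = some (!ε) ∧
      (col 0 3 = some (!ε) ∨ col 0 4 = some (!ε)) := by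
  have n8 := T.noOctagon ε
  have s {x y o} : col x y = o → col y x = o := T.symm'
  refine ⟨(T.colored (by decide) (by decide)).resolve_left fun h => ?_,
    (T.colored (by decide) (by decide)).resolve_left fun h => ?_, ?_⟩
  · exact n8 (.of_eight 0 1 7 2 3 4 5 6 (by decide) T.e0 (s (T.seven T.e0)) (T.seven h) T.e2 T.e3
      T.e4 T.e5 (s T.six))
  · exact n8 (.of_eight 0 1 2 3 4 5 7 6 (by decide) T.e0 T.e1 T.e2 T.e3 T.e4 (s (T.seven h))
      (s T.e6) (s T.six))
  · rcases T.colored (x := 3) (by decide) (by decide) with h3 | h3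
    · refine .inr ((T.colored (by decide) (by decide)).resolve_left fun h4 => ?_)
      exact n8 (.of_eight 0 1 2 3 7 4 5 6 (by decide) T.e0 T.e1 T.e2 (s (T.seven h3)) (T.seven h4)
        T.e4 T.e5 (s T.six))
    · exact .inl h3

/-- A red and a blue neighbour of the twins are not twins of each other, so if they are not joined
in red, they are joined in blue. -/
theorem cross (T : TwinPath col ε) {x y : Fin 11} (hx : col 0 x = some ε)
    (hy : col 0 y = some (!ε)) (h : col x y = some ε → False) : col x y = some (!ε) := by
  by_contra hne
  rcases eq_none_or_eq_some_of_ne hne with h' | h'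
  · exact T.blowup.ne_none hx hy h'
  · exact h h'

theorem blue_three (T : TwinPath col ε) {r : Fin 11} (hr8 : 8 ≤ r) (hr : col 0 r = some ε)
    (h3 : col 0 3 = some (!ε)) : col r 3 = some (!ε) :=
  T.cross hr h3 fun h => T.noOctagon ε <| .of_eight 0 r 3 4 5 6 7 1
    (by clear * - hr8; decide +revert) hr h T.e3 T.e4 T.e5 T.e6 (T.seven T.e0) (T.symm' T.e0)

/-- The case that on the path `1, …, 6` only the ends are red neighbours of the twins. -/
theorem false_of_ends (T : TwinPath col ε) (h3 : col 0 3 = some (!ε)) (h4 : col 0 4 = some (!ε))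
    (h8 : col 0 8 = some ε) (h9 : col 0 9 = some ε) (h10 : col 0 10 = some ε) : False := by
  have s {x y o} : col x y = o → col y x = o := T.symm'
  obtain ⟨h2, h5, -⟩ := T.not_consecutive
  have hr : ∀ r : Fin 11, 8 ≤ r → col 0 r = some ε := by
    intro r hr
    obtain rfl | rfl | rfl : r = 8 ∨ r = 9 ∨ r = 10 := by clear * - hr; decide +revert
    all_goals assumption
  have b3 : ∀ r : Fin 11, 8 ≤ r → col r 3 = some (!ε) := fun r h => T.blue_three h (hr r h) h3
  have b4 : ∀ r : Fin 11, 8 ≤ r → col r 4 = some (!ε) := fun r h8 =>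
    T.cross (hr r h8) h4 fun h => T.noOctagon ε <| .of_eight 0 r 4 3 2 1 7 6
      (by clear * - h8; decide +revert) (hr r h8) h (s T.e3) (s T.e2) (s T.e1) (s (T.seven T.e0))
      (s T.e6) (s T.six)
  have k25 : ∀ r r' : Fin 11, 8 ≤ r → 8 ≤ r' → r ≠ r' →
      col r 2 = some ε → col r' 5 = some ε → False := fun r r' h8 h8' hne hr2 hr5 =>
    T.noOctagon ε <| .of_eight 0 1 2 r 7 r' 5 6 (by clear * - h8 h8' hne; decide +revert) T.e0
      T.e1 (s hr2) (s (T.seven (hr r h8))) (T.seven (hr r' h8')) hr5 T.e5 (s T.six)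
  have k2 : ∀ r r' : Fin 11, 8 ≤ r → 8 ≤ r' → r ≠ r' →
      col r 2 = some (!ε) → col r' 2 = some (!ε) → False := fun r r' h8 h8' hne hr2 hr2' =>
    T.noOctagon (!ε) <| .of_eight 5 0 3 r 2 r' 4 7 (by clear * - h8 h8' hne; decide +revert) (s h5)
      h3 (s (b3 r h8)) hr2 (s hr2') (b4 r' h8') (s (T.seven h4)) (T.seven h5)
  have k5 : ∀ r r' : Fin 11, 8 ≤ r → 8 ≤ r' → r ≠ r' →
      col r 5 = some (!ε) → col r' 5 = some (!ε) → False := fun r r' h8 h8' hne hr5 hr5' =>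
    T.noOctagon (!ε) <| .of_eight 2 0 4 r 5 r' 3 7 (by clear * - h8 h8' hne; decide +revert) (s h2)
      h4 (s (b4 r h8)) hr5 (s hr5') (b3 r' h8') (s (T.seven h3)) (T.seven h2)
  have c2 : ∀ r : Fin 11, 8 ≤ r → col r 2 = some ε ∨ col r 2 = some (!ε) := fun r h8 =>
    or_iff_not_imp_left.2 (T.cross (hr r h8) h2)
  have c5 : ∀ r : Fin 11, 8 ≤ r → col r 5 = some ε ∨ col r 5 = some (!ε) := fun r h8 =>
    or_iff_not_imp_left.2 (T.cross (hr r h8) h5)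
  have l8 : (8 : Fin 11) ≤ 8 := by decide
  have l9 : (8 : Fin 11) ≤ 9 := by decide
  have l10 : (8 : Fin 11) ≤ 10 := by decide
  have n89 : (8 : Fin 11) ≠ 9 := by decide
  have n810 : (8 : Fin 11) ≠ 10 := by decide
  have n910 : (9 : Fin 11) ≠ 10 := by decide
  -- At most one of `8, 9, 10` is joined to `2` in blue, so two are joined to it in red; the same
  -- holds for `5`.
  have p1 := k2 8 9 l8 l9 n89
  have p2 := k2 8 10 l8 l10 n810
  have p3 := k2 9 10 l9 l10 n910
  have q1 := k5 8 9 l8 l9 n89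
  have q2 := k5 8 10 l8 l10 n810
  have q3 := k5 9 10 l9 l10 n910
  have r1 := k25 8 9 l8 l9 n89
  have r2 := k25 8 10 l8 l10 n810
  have r3 := k25 9 10 l9 l10 n910
  have r4 := k25 9 8 l9 l8 n89.symm
  rcases c2 8 l8 with u1 | u1 <;> rcases c2 9 l9 with u2 | u2 <;> rcases c2 10 l10 with u3 | u3 <;>
    rcases c5 8 l8 with v1 | v1 <;> rcases c5 9 l9 with v2 | v2 <;>
    rcases c5 10 l10 with v3 | v3 <;>
    first
      | exact p1 u1 u2 | exact p2 u1 u3 | exact p3 u2 u3 | exact q1 v1 v2 | exact q2 v1 v3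
      | exact q3 v2 v3 | exact r1 u1 v2 | exact r2 u1 v3 | exact r3 u2 v3 | exact r4 u2 v1

/-- The case that `4` and two further vertices off the path are red neighbours of the twins. -/
theorem false_of_four (T : TwinPath col ε) (h4 : col 0 4 = some ε) (h8 : col 0 8 = some ε)
    (h9 : col 0 9 = some ε) : False := by
  have s {x y o} : col x y = o → col y x = o := T.symm'
  obtain ⟨h2, h5, h34⟩ := T.not_consecutive
  have h3 : col 0 3 = some (!ε) := h34.resolve_right (by rw [h4]; cases ε <;> simp)
  have b3 : ∀ r : Fin 11, 8 ≤ r → col 0 r = some ε → col r 3 = some (!ε) :=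
    fun r h hr => T.blue_three h hr h3
  have b2 : ∀ r : Fin 11, 8 ≤ r → col 0 r = some ε → col r 2 = some (!ε) := fun r h8 hr =>
    T.cross hr h2 fun h => T.noOctagon ε <| .of_eight 0 r 2 1 7 4 5 6
      (by clear * - h8; decide +revert) hr h (s T.e1) (s (T.seven T.e0)) (T.seven h4) T.e4 T.e5
      (s T.six)
  have b38 := b3 8 (by decide) h8
  have b39 := b3 9 (by decide) h9
  have b28 := b2 8 (by decide) h8
  have b29 := b2 9 (by decide) h9
  rcases T.colored (x := 10) (by decide) (by decide) with h10 | h10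
  · have b310 := b3 10 (by decide) h10
    have b210 := b2 10 (by decide) h10
    have hr : ∀ r : Fin 11, 8 ≤ r → col 0 r = some ε := by
      intro r hr
      obtain rfl | rfl | rfl : r = 8 ∨ r = 9 ∨ r = 10 := by clear * - hr; decide +revert
      all_goals assumption
    have nr : ∀ r r' : Fin 11, 8 ≤ r → 8 ≤ r' → r ≠ r' →
        col r r' = none ∨ col r r' = some (!ε) := by
      intro r r' h8 h8' hne
      by_contra! hc
      refine T.noOctagon ε (.of_eight 0 r r' 7 1 2 3 4 (by clear * - h8 h8' hne; decide +revert)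
        (hr r h8) ((eq_none_or_eq_some_of_ne hc.2).resolve_left hc.1) (s (T.seven (hr r' h8')))
        (T.seven T.e0) T.e1 T.e2 T.e3 (s h4))
    have path : ∀ a b d : Fin 11, 8 ≤ a → 8 ≤ b → 8 ≤ d → [a, b, d].Nodup →
        col a b = some (!ε) → col b d = some (!ε) → False := fun a b d ha hb hd hnd hab hbd =>
      T.noOctagon (!ε) <| .of_eight 5 0 2 a b d 3 7 (by clear * - ha hb hd hnd; decide +revert)
        (s h5) h2 (s (b2 a ha (hr a ha))) hab hbd (b3 d hd (hr d hd)) (s (T.seven h3)) (T.seven h5)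
    have trip : ∀ a b d : Fin 11, [a, b, d].Nodup → col a b = none → col b d = none → False :=
      fun a b d hnd hab hbd => T.noTriple (x := b) (y := a) (z := d)
        (by clear * - hnd; decide +revert) (s hab) hbd
    rcases nr 8 9 (by decide) (by decide) (by decide) with u | u <;>
      rcases nr 9 10 (by decide) (by decide) (by decide) with v | v <;>
      rcases nr 10 8 (by decide) (by decide) (by decide) with w | w
    · exact trip 8 9 10 (by decide) u v
    · exact trip 8 9 10 (by decide) u v
    · exact trip 10 8 9 (by decide) w u
    · exact path 9 10 8 (by decide) (by decide) (by decide) (by decide) v w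
    · exact trip 9 10 8 (by decide) v w
    · exact path 10 8 9 (by decide) (by decide) (by decide) (by decide) w u
    · exact path 8 9 10 (by decide) (by decide) (by decide) (by decide) u v
    · exact path 8 9 10 (by decide) (by decide) (by decide) (by decide) u v
  · have k : ∀ r r' : Fin 11, (r = 8 ∧ r' = 9) ∨ (r = 9 ∧ r' = 8) → col r 10 = some ε := by
      intro r r' hrr
      have hr8 : 8 ≤ r ∧ 8 ≤ r' := by clear * - hrr; decide +revert
      have hr : col 0 r = some ε ∧ col 0 r' = some ε := by
        rcases hrr with ⟨rfl, rfl⟩ | ⟨rfl, rfl⟩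
        · exact ⟨h8, h9⟩
        · exact ⟨h9, h8⟩
      by_contra hc
      have hb := T.cross hr.1 h10 hc
      exact T.noOctagon (!ε) (.of_eight 10 r 2 r' 3 0 5 7 (by clear * - hrr; decide +revert) (s hb)
        (b2 r hr8.1 hr.1) (s (b2 r' hr8.2 hr.2)) (b3 r' hr8.2 hr.2) (s h3) h5 (s (T.seven h5))
        (T.seven h10))
    exact T.noOctagon ε (.of_eight 0 8 10 9 7 4 5 6 (by decide) h8 (k 8 9 (by decide))
      (s (k 9 8 (by decide))) (s (T.seven h9)) (T.seven h4) T.e4 T.e5 (s T.six))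

theorem false_of_four_of_card (T : TwinPath col ε) (h4 : col 0 4 = some ε)
    (hcard : 5 ≤ (Finset.univ.filter fun x => col 0 x = some ε).card) : False := by
  obtain ⟨h2, h5, h34⟩ := T.not_consecutive
  have h3 : col 0 3 = some (!ε) := h34.resolve_right (by rw [h4]; cases ε <;> simp)
  have ne : (some (!ε) : Option Bool) ≠ some ε := by cases ε <;> simp
  rw [Finset.card_filter] at hcard
  simp only [Fin.sum_univ_succ, Fin.sum_univ_zero] at hcard
  simp only [T.blowup.diag, h2, h3, h5, T.twins, Fin.reduceSucc, Fin.succ_zero_eq_one,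
    Fin.succ_one_eq_two, ne, reduceCtorEq, if_false] at hcard
  by_cases h8 : col 0 8 = some ε
  · by_cases h9 : col 0 9 = some ε
    · exact T.false_of_four h4 h8 h9
    · by_cases h10 : col 0 10 = some ε
      · exact (T.comap (g := ![0, 1, 2, 3, 4, 5, 6, 7, 8, 10, 9]) (by decide)
          (.inl (by decide))).false_of_four h4 h8 h10
      · simp only [h9, h10, if_false] at hcard
        split_ifs at hcard <;> omega
  · by_cases h9 : col 0 9 = some ε
    · by_cases h10 : col 0 10 = some ε
      · exact (T.comap (g := ![0, 1, 2, 3, 4, 5, 6, 7, 9, 10, 8]) (by decide)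
          (.inl (by decide))).false_of_four h4 h9 h10
      · simp only [h8, h10, if_false] at hcard
        split_ifs at hcard <;> omega
    · simp only [h8, h9, if_false] at hcard
      split_ifs at hcard <;> omega

/-- The twins have at most four red neighbours. -/
theorem false_of_card (T : TwinPath col ε)
    (hcard : 5 ≤ (Finset.univ.filter fun x => col 0 x = some ε).card) : False := by
  rcases T.colored (x := 4) (by decide) (by decide) with h4 | h4
  · exact T.false_of_four_of_card h4 hcard
  rcases T.colored (x := 3) (by decide) (by decide) with h3 | h3
  · -- Read the path backwards.
    have hg : Function.Injective (![7, 6, 5, 4, 3, 2, 1, 0, 8, 9, 10] : Fin 11 → Fin 11) := by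
      decide
    refine (T.comap hg (.inr rfl)).false_of_four_of_card (T.seven h3) (hcard.trans ?_)
    refine Finset.card_le_card_of_injOn _ (fun x hx => ?_) hg.injOn
    have hinv : ∀ x : Fin 11, (![7, 6, 5, 4, 3, 2, 1, 0, 8, 9, 10] : Fin 11 → Fin 11)
        ((![7, 6, 5, 4, 3, 2, 1, 0, 8, 9, 10] : Fin 11 → Fin 11) x) = x := by decide
    simp only [Finset.coe_filter, Finset.mem_univ, true_and, Set.mem_ofPred_eq] at hx ⊢
    rw [hinv]
    exact T.seven hx
  · obtain ⟨h2, h5, -⟩ := T.not_consecutive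
    have ne : (some (!ε) : Option Bool) ≠ some ε := by cases ε <;> simp
    rw [Finset.card_filter] at hcard
    simp only [Fin.sum_univ_succ, Fin.sum_univ_zero] at hcard
    simp only [T.blowup.diag, h2, h3, h4, h5, T.twins, Fin.reduceSucc, Fin.succ_zero_eq_one,
      Fin.succ_one_eq_two, ne, reduceCtorEq, if_false] at hcard
    refine T.false_of_ends h3 h4 ?_ ?_ ?_
    all_goals
      by_contra hc
      simp only [hc, if_false] at hcard
      split_ifs at hcard <;> omega

end TwinPath

/-! ### Blow-ups on eleven vertices contain a monochromatic `C₈` -/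

theorem IsBlowup.recolor {col : Fin 11 → Fin 11 → Option Bool} (h : IsBlowup col)
    (noTriple : ∀ {x y z}, [x, y, z].Nodup → col x y = none → col x z = none → False)
    {u v : Fin 11} (huv : u ≠ v) (h0 : col u v = none) (ε : Bool) :
    IsBlowup fun x y => if (x = u ∧ y = v) ∨ (x = v ∧ y = u) then some ε else col x y where
  symm x y := by
    rw [h.symm x y]
    exact if_congr (by tauto) rfl rfl
  diag x := by
    rw [if_neg (by rintro (⟨rfl, rfl⟩ | ⟨rfl, rfl⟩) <;> exact huv rfl)]
    exact h.diag x
  twin := by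
    intro x y hxy z
    obtain rfl | hne := eq_or_ne x y
    · rfl
    have hv0 : col v u = none := (h.symm _ _).trans h0
    by_cases hc : (x = u ∧ y = v) ∨ (x = v ∧ y = u)
    · simp [hc] at hxy
    rw [if_neg hc] at hxy
    have hyx : col y x = none := (h.symm _ _).trans hxy
    have hxu : x ≠ u := by
      rintro rfl
      refine noTriple (x := x) (y := v) (z := y) ?_ h0 hxy
      simp only [List.nodup_cons, List.mem_cons, List.not_mem_nil, or_false, not_or,
        List.nodup_nil, not_false_eq_true, and_true]
      exact ⟨⟨huv, hne⟩, fun hvy => hc (.inl ⟨rfl, hvy.symm⟩)⟩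
    have hxv : x ≠ v := by
      rintro rfl
      refine noTriple (x := x) (y := u) (z := y) ?_ hv0 hxy
      simp only [List.nodup_cons, List.mem_cons, List.not_mem_nil, or_false, not_or,
        List.nodup_nil, not_false_eq_true, and_true]
      exact ⟨⟨huv.symm, hne⟩, fun hvy => hc (.inr ⟨rfl, hvy.symm⟩)⟩
    have hyu : y ≠ u := by
      rintro rfl
      refine noTriple (x := y) (y := v) (z := x) ?_ h0 hyx
      simp only [List.nodup_cons, List.mem_cons, List.not_mem_nil, or_false, not_or,
        List.nodup_nil, not_false_eq_true, and_true]
      exact ⟨⟨huv, hne.symm⟩, hxv.symm⟩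
    have hyv : y ≠ v := by
      rintro rfl
      refine noTriple (x := y) (y := u) (z := x) ?_ hv0 hyx
      simp only [List.nodup_cons, List.mem_cons, List.not_mem_nil, or_false, not_or,
        List.nodup_nil, not_false_eq_true, and_true]
      exact ⟨⟨huv.symm, hne.symm⟩, hxu.symm⟩
    simpa [hxu, hxv, hyu, hyv] using h.twin hxy z
  small := by
    intro x y z w hnd hxy hxz hxw
    have aux : ∀ {y}, (if (x = u ∧ y = v) ∨ (x = v ∧ y = u) then some ε else col x y) = none →
        col x y = none := by
      intro y hy
      by_contra hne
      split_ifs at hy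
      exact hne hy
    exact h.small hnd (aux hxy) (aux hxz) (aux hxw)

/-- Induction on the number of uncoloured pairs. If there are three pairwise uncoloured vertices or
no uncoloured pair at all, this has been treated. Otherwise colour the pair of some twins in the
majority colour of their neighbours; a monochromatic `C₈` using the new edge makes the
configuration of a `TwinPath`. -/
theorem IsBlowup.not_noOctagon {col : Fin 11 → Fin 11 → Option Bool} (h : IsBlowup col) :
    ¬ NoOctagon col := by
  induction hN : (Finset.univ.filter fun p : Fin 11 × Fin 11 => col p.1 p.2 = none).card
    using Nat.strong_induction_on generalizing col with
  | _ N ih =>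
  intro n8
  have noTriple : ∀ {x y z}, [x, y, z].Nodup → col x y = none → col x z = none → False :=
    fun hnd hxy hxz => h.false_of_triple n8 hnd hxy hxz
  by_cases hex : ∃ u v, u ≠ v ∧ col u v = none
  · obtain ⟨u, v, huv, h0⟩ := hex
    obtain ⟨ε, hε⟩ : ∃ ε, 5 ≤ (Finset.univ.filter fun x => col u x = some ε).card := by
      have h2 : (Finset.univ.filter fun x => col u x = none) = {u, v} := by
        ext x
        simp only [Finset.mem_filter, Finset.mem_univ, true_and, Finset.mem_insert,
          Finset.mem_singleton]
        constructor
        · intro hx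
          by_contra! hne
          refine noTriple ?_ h0 hx
          simp [huv, hne.1.symm, hne.2.symm]
        · rintro (rfl | rfl)
          · exact h.diag _
          · exact h0
      have hsum := card_fibers_add (col u) true
      rw [h2, Finset.card_pair huv] at hsum
      by_contra! hlt
      have := hlt true
      have := hlt false
      simp only [Bool.not_true] at hsum
      omega
    refine ih _ ?_ (h.recolor noTriple huv h0 ε) rfl fun δ hcyc => ?_
    · rw [← hN]
      refine Finset.card_lt_card (Finset.ssubset_iff_of_subset ?_ |>.2 ⟨(u, v), ?_, ?_⟩)
      · intro p hp
        simp only [Finset.mem_filter, Finset.mem_univ, true_and] at hp ⊢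
        by_contra hne
        split_ifs at hp
        exact hne hp
      · simpa using h0
      · simp
    obtain ⟨f, hf, hcol⟩ := hcyc
    dsimp only at hcol
    by_cases hall : ∀ i, ¬ ((f i = u ∧ f (i + 1) = v) ∨ (f i = v ∧ f (i + 1) = u))
    · refine n8 δ ⟨f, hf, fun i => ?_⟩
      have := hcol i
      rwa [if_neg (hall i)] at this
    · push Not at hall
      obtain ⟨i, hi⟩ := hall
      have hδ : ε = δ := by
        have := hcol i
        rw [if_pos hi] at this
        exact Option.some.inj this
      subst hδ
      -- Remove the new edge from the cycle and extend the remaining path to an enumeration.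
      obtain ⟨g, hg, hgf⟩ := exists_injective_extension (by norm_num : 8 ≤ 11)
        (fun j : Fin 8 => f (i + 1 + j)) (hf.comp (add_right_injective _))
      have g0 : g 0 = f (i + 1) := by simpa using hgf 0
      have g7 : g 7 = f i := by
        have := hgf 7
        have h8 : i + 1 + 7 = i := by clear * -; revert i; decide
        rwa [h8] at this
      have hedge : ∀ j : Fin 8, j ≠ 7 →
          col (g (Fin.castLE (by norm_num) j)) (g (Fin.castLE (by norm_num) (j + 1))) = some ε := by
        intro j hj
        rw [hgf, hgf, ← add_assoc (i + 1) j 1]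
        have := hcol (i + 1 + j)
        rw [if_neg] at this
        · exact this
        · have n1 : f (i + 1 + j) ≠ f i := fun h =>
            hj (by have := hf h; clear * - this; revert i j; decide)
          have n2 : f (i + 1 + j + 1) ≠ f (i + 1) := fun h =>
            hj (by have := hf h; clear * - this; revert i j; decide)
          have n3 : f (i + 1 + j) = f (i + 1) → f (i + 1 + j + 1) ≠ f i := fun h h' => by
            have h1 := hf h
            have h2 := hf h'
            clear * - h1 h2
            revert i j
            decide
          rcases hi with ⟨h1, h2⟩ | ⟨h1, h2⟩ <;> rw [← h1, ← h2] <;> tauto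
      have hrow : ∀ x, col (g 0) x = col u x := by
        intro x
        rw [g0]
        rcases hi with ⟨h1, h2⟩ | ⟨h1, h2⟩
        · rw [h2, h.twin h0]
        · rw [h2]
      have T : TwinPath (fun x y => col (g x) (g y)) ε :=
        { blowup :=
            { symm := fun _ _ => h.symm _ _
              diag := fun _ => h.diag _
              twin := fun h' _ => h.twin h' _
              small := fun hnd => h.small (List.Nodup.map hg hnd) }
          noOctagon := fun δ hc => n8 δ (hc.comap hg)
          noTriple := fun hnd => noTriple (List.Nodup.map hg hnd)
          twins := by
            rw [g0, g7]
            rcases hi with ⟨h1, h2⟩ | ⟨h1, h2⟩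
            · rw [h1, h2, h.symm]; exact h0
            · rw [h1, h2]; exact h0
          e0 := hedge 0 (by decide)
          e1 := hedge 1 (by decide)
          e2 := hedge 2 (by decide)
          e3 := hedge 3 (by decide)
          e4 := hedge 4 (by decide)
          e5 := hedge 5 (by decide)
          e6 := hedge 6 (by decide) }
      refine T.false_of_card (hε.trans (le_of_eq ?_))
      let e := Equiv.ofBijective g (Finite.injective_iff_bijective.1 hg)
      refine (Finset.card_bij (fun x _ => e x) ?_ (fun _ _ _ _ h => e.injective h) ?_).symm
      · intro x hx
        simp only [Finset.mem_filter, Finset.mem_univ, true_and] at hx ⊢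
        rw [← hrow]
        exact hx
      · intro y hy
        refine ⟨e.symm y, ?_, e.apply_symm_apply y⟩
        simp only [Finset.mem_filter, Finset.mem_univ, true_and] at hy ⊢
        rw [hrow]
        change col u (e (e.symm y)) = _
        rwa [e.apply_symm_apply]
  · push Not at hex
    have key : NoMono 8 fun x y => col x y == some true := by
      intro ε ⟨f, hf, hcol⟩
      refine n8 ε ⟨f, hf, fun i => ?_⟩
      change col (f i) (f (i + 1)) = some ε
      have hne := hex (f i) (f (i + 1)) fun h => by
        have := hf h
        clear * - this
        revert i
        decide
      have : (col (f i) (f (i + 1)) == some true) = ε := hcol i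
      generalize col (f i) (f (i + 1)) = o at *
      clear * - hne this
      revert o ε
      decide
    exact not_noMono_eight (fun x y => by rw [h.symm]) key

/-! ### Gallai colourings -/

section Gallai

variable {V K : Type*} {c : V → V → K} {s : Finset V} {P : K → Prop} {x y z : V}

/-- `c`, read off the diagonal, is an edge colouring without rainbow triangles. -/
structure IsGallai (c : V → V → K) : Prop where
  symm : ∀ x y, c x y = c y x
  triangle : ∀ {x y z}, x ≠ y → y ≠ z → x ≠ z → c x y = c y z ∨ c y z = c x z ∨ c x y = c x z

/-- `x` and `y` are joined by a walk in `s` all of whose edges have colours satisfying `P`. -/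
def Joined (c : V → V → K) (P : K → Prop) (s : Finset V) : V → V → Prop :=
  Relation.ReflTransGen fun x y => x ∈ s ∧ y ∈ s ∧ P (c x y)

theorem Joined.symm (hc : IsGallai c) (h : Joined c P s x y) : Joined c P s y x := by
  have : Std.Symm fun x y => x ∈ s ∧ y ∈ s ∧ P (c x y) :=
    ⟨fun x y h => ⟨h.2.1, h.1, by rw [hc.symm]; exact h.2.2⟩⟩
  exact Relation.ReflTransGen.stdSymm.symm _ _ h

theorem Joined.mem (h : Joined c P s x y) (hx : x ∈ s) : y ∈ s := by
  induction h with
  | refl => exact hx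
  | tail _ h _ => exact h.2.1

theorem Joined.trans (h : Joined c P s x y) (h' : Joined c P s y z) : Joined c P s x z :=
  Relation.ReflTransGen.trans h h'

theorem Joined.refl : Joined c P s x x := Relation.ReflTransGen.refl

theorem Joined.single (hx : x ∈ s) (hy : y ∈ s) (h : P (c x y)) : Joined c P s x y :=
  Relation.ReflTransGen.single ⟨hx, hy, h⟩

theorem Joined.mono {Q : K → Prop} (h : Joined c P s x y) (hPQ : ∀ k, P k → Q k) :
    Joined c Q s x y :=
  Relation.ReflTransGen.mono (fun _ _ h => ⟨h.1, h.2.1, hPQ _ h.2.2⟩) _ _ h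

/-- The components of the graph formed by some of the colours of a Gallai colouring are modules. -/
theorem Joined.color_eq (hc : IsGallai c) (h : Joined c P s x y) (hz : z ∈ s)
    (hxz : ¬ Joined c P s x z) : c x z = c y z := by
  induction h with
  | refl => rfl
  | @tail a b hab hstep ih =>
    have ha : ¬ Joined c P s a z := fun h => hxz (Joined.trans hab h)
    have hb : ¬ Joined c P s b z := fun h => ha (.trans (.single hstep.1 hstep.2.1 hstep.2.2) h)
    rw [ih]
    obtain rfl | hne := eq_or_ne a b
    · rfl
    rcases hc.triangle (x := a) (y := b) (z := z) hne (fun h => hb (h ▸ .refl))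
      (fun h => ha (h ▸ .refl)) with h | h | h
    · exact (hb (.single hstep.2.1 hz (h ▸ hstep.2.2))).elim
    · exact h.symm
    · exact (ha (.single hstep.1 hz (h ▸ hstep.2.2))).elim

/-- The colours satisfying `P` form a connected spanning subgraph on `s`. -/
def Spanning (c : V → V → K) (P : K → Prop) (s : Finset V) : Prop :=
  ∀ x ∈ s, ∀ y ∈ s, Joined c P s x y

variable [DecidableEq V]

/-- If the colours in `P` span `s`, then `v` has a neighbour in each component of `s \ {v}`. -/
theorem Joined.exists_neighbor {v : V} (h : Joined c P s x v) (hx : x ∈ s.erase v) :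
    ∃ w ∈ s.erase v, Joined c P (s.erase v) x w ∧ P (c w v) := by
  induction h using Relation.ReflTransGen.head_induction_on with
  | refl => simp at hx
  | @head a b hab hb ih =>
    obtain rfl | hbv := eq_or_ne b v
    · exact ⟨a, hx, .refl, hab.2.2⟩
    · have hb' := Finset.mem_erase.2 ⟨hbv, hab.2.1⟩
      obtain ⟨w, hw, h1, h2⟩ := ih hb'
      exact ⟨w, hw, .trans (.single hx hb' hab.2.2) h1, h2⟩

/-- If the colour `i` spans `s` and the vertex `v` is incident to edges in two other colours `j` and
`l`, then `i` still spans after the removal of `v`. Otherwise `v` sends colour `i` into each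
component of colour `i`. So the ends `u` and `u'` of the edges in colours `j` and `l` force two
different colours between two of these components. -/
theorem Spanning.false_of_not_spanning_erase (hc : IsGallai c) {i j l : K} (hij : i ≠ j)
    (hil : i ≠ l) (hjl : j ≠ l) {v u u' : V} (hv : v ∈ s) (hi : Spanning c (· = i) s)
    (hu : u ∈ s.erase v) (hu' : u' ∈ s.erase v) (hju : c u v = j) (hlu : c u' v = l)
    (hn : ¬ Spanning c (· = i) (s.erase v)) : False := by
  have nb : ∀ x ∈ s.erase v, ∃ w ∈ s.erase v, Joined c (· = i) (s.erase v) x w ∧ c w v = i :=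
    fun x hx => (hi x (Finset.mem_of_mem_erase hx) v hv).exists_neighbor hx
  have ne : ∀ x ∈ s.erase v, x ≠ v := fun x hx => Finset.ne_of_mem_erase hx
  -- A vertex `a` sending colour `m ≠ i` to `v` sends the same colour to every vertex in another
  -- component which sends colour `i` to `v`.
  have key : ∀ a ∈ s.erase v, ∀ w ∈ s.erase v, ∀ m, i ≠ m → c a v = m → c w v = i →
      ¬ Joined c (· = i) (s.erase v) a w → c a w = m := by
    intro a ha w hw m hm hav hwv haw
    have hq : c a w ≠ i := fun h => haw (.single ha hw h)
    rcases hc.triangle (x := a) (y := w) (z := v) (fun h => haw (h ▸ .refl)) (ne w hw) (ne a ha)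
      with h | h | h
    · exact (hq (h.trans hwv)).elim
    · exact (hm (hwv.symm.trans (h.trans hav))).elim
    · exact h.trans hav
  by_cases huu : Joined c (· = i) (s.erase v) u u'
  · obtain ⟨w, hw, huw⟩ : ∃ w ∈ s.erase v, ¬ Joined c (· = i) (s.erase v) u w := by
      by_contra! hcon
      exact hn fun x hx y hy => ((hcon x hx).symm hc).trans (hcon y hy)
    obtain ⟨w', hw', hww, hwi⟩ := nb w hw
    have h1 : ¬ Joined c (· = i) (s.erase v) u w' := fun h => huw (h.trans (hww.symm hc))
    have h2 : ¬ Joined c (· = i) (s.erase v) u' w' := fun h => h1 (huu.trans h)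
    exact hjl ((key u hu w' hw' j hij hju hwi h1).symm.trans
      ((huu.color_eq hc hw' h1).trans (key u' hu' w' hw' l hil hlu hwi h2)))
  · obtain ⟨w, hw, huw, hwi⟩ := nb u hu
    obtain ⟨w', hw', huw', hwi'⟩ := nb u' hu'
    have huu' : ¬ Joined c (· = i) (s.erase v) u' u := fun h => huu (h.symm hc)
    have e1 := huw.color_eq hc hu' huu
    have e2 := huw'.color_eq hc hu huu'
    have k1 := key u hu w' hw' j hij hju hwi' fun h => huu (h.trans (huw'.symm hc))
    have k2 := key u' hu' w hw l hil hlu hwi fun h => huu' (h.trans (huw.symm hc))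
    refine hjl (k1.symm.trans ?_)
    rw [hc.symm u w', ← e2, hc.symm u' u, e1, hc.symm w u', k2]

/-- Three distinct colours of a Gallai colouring cannot all span: remove a vertex and use
induction. -/
theorem IsGallai.not_spanning_three (hc : IsGallai c) {i : Fin 3 → K} (hi : Function.Injective i)
    (hs : 2 ≤ s.card) : ∃ m, ¬ Spanning c (· = i m) s := by
  induction hn : s.card using Nat.strong_induction_on generalizing s with
  | _ n ih =>
  by_contra! hsp
  obtain ⟨v, hv, a, ha, hva⟩ := Finset.one_lt_card.1 hs
  have hae : a ∈ s.erase v := Finset.mem_erase.2 ⟨hva.symm, ha⟩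
  have nb : ∀ m, ∃ w ∈ s.erase v, c w v = i m := fun m => by
    obtain ⟨w, hw, -, h⟩ := (hsp m a ha v hv).exists_neighbor hae
    exact ⟨w, hw, h⟩
  have hcard := Finset.card_erase_of_mem hv
  obtain ⟨m, hm⟩ : ∃ m, ¬ Spanning c (· = i m) (s.erase v) := by
    refine ih _ (by omega) ?_ rfl
    obtain ⟨w, hw, hwv⟩ := nb 0
    obtain ⟨w', hw', hwv'⟩ := nb 1
    refine Finset.one_lt_card.2 ⟨w, hw, w', hw', ?_⟩
    rintro rfl
    have := hi (hwv.symm.trans hwv')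
    revert this
    decide
  have ne : ∀ m : Fin 3, m ≠ m + 1 ∧ m ≠ m + 2 ∧ m + 1 ≠ m + 2 := by decide
  obtain ⟨u, hu, huv⟩ := nb (m + 1)
  obtain ⟨u', hu', huv'⟩ := nb (m + 2)
  exact Spanning.false_of_not_spanning_erase hc (hi.ne (ne m).1) (hi.ne (ne m).2.1)
    (hi.ne (ne m).2.2) hv (hsp m) hu hu' huv huv' hm

/-- Gallai's theorem: there are two colours such that the remaining ones do not span. Take a maximal
set of colours that does not span; contracting its components, each of the other colours spans the
quotient, so there are at most two of them. -/
theorem IsGallai.exists_not_spanning [Fintype K] [DecidableEq K] (hc : IsGallai c)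
    (hs : 2 ≤ s.card) (hK : 2 ≤ Fintype.card K) :
    ∃ r b, r ≠ b ∧ ¬ Spanning c (fun k => k ≠ r ∧ k ≠ b) s := by
  classical
  obtain ⟨a, ha, a', ha', haa⟩ := Finset.one_lt_card.1 hs
  obtain ⟨S, hS, hmax⟩ := Finset.exists_max_image
    (Finset.univ.filter fun S : Finset K => ¬ Spanning c (· ∈ S) s) Finset.card
    ⟨∅, by
      simp only [Finset.mem_filter, Finset.mem_univ, true_and]
      intro h
      have := h a ha a' ha'
      rcases Relation.ReflTransGen.cases_head this with h | ⟨_, h, -⟩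
      · exact haa h
      · exact absurd h.2.2 (Finset.notMem_empty _)⟩
  simp only [Finset.mem_filter, Finset.mem_univ, true_and] at hS hmax
  by_cases hcard : Sᶜ.card ≤ 2
  · obtain ⟨t, hSt, ht⟩ := Finset.exists_superset_card_eq hcard hK
    obtain ⟨r, b, hrb, rfl⟩ := Finset.card_eq_two.1 ht
    refine ⟨r, b, hrb, fun h => hS fun x hx y hy => (h x hx y hy).mono fun k hk => ?_⟩
    by_contra hkS
    have := hSt (Finset.mem_compl.2 hkS)
    simp only [Finset.mem_insert, Finset.mem_singleton] at this
    tauto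
  · -- Contract the components of the colours in `S`; each other colour spans the quotient.
    exfalso
    let st : Setoid V := 
      ⟨Joined c (· ∈ S) s, fun _ => .refl, fun h => h.symm hc, fun h h' => h.trans h'⟩
    let ρ : V → V := fun x => (Quotient.mk st x).out
    have hρ : ∀ x, Joined c (· ∈ S) s x (ρ x) := fun x => by
      have : st (ρ x) x := Quotient.mk_out x
      exact Joined.symm hc this
    have hρ' : ∀ {x y}, Joined c (· ∈ S) s x y → ρ x = ρ y := fun {x y} h => by
      have : Quotient.mk st x = Quotient.mk st y := Quotient.sound h
      simp only [ρ, this]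
    have hspan : ∀ i ∉ S, Spanning c (· = i) (s.image ρ) := by
      intro i hi
      have hins : Spanning c (· ∈ insert i S) s := by
        by_contra hcon
        have := hmax _ hcon
        rw [Finset.card_insert_of_notMem hi] at this
        omega
      have step : ∀ x y, Joined c (· ∈ insert i S) s x y →
          Joined c (· = i) (s.image ρ) (ρ x) (ρ y) := by
        intro x y h
        induction h with
        | refl => exact .refl
        | @tail a b _ hab ih =>
          refine ih.trans ?_
          by_cases hj : Joined c (· ∈ S) s a b
          · rw [hρ' hj]
            exact .refl
          · have hi' : c a b = i := by
              rcases Finset.mem_insert.1 hab.2.2 with h | h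
              · exact h
              · exact (hj (.single hab.1 hab.2.1 h)).elim
            refine .single (Finset.mem_image_of_mem _ hab.1) (Finset.mem_image_of_mem _ hab.2.1) ?_
            have hb := (hρ b).mem hab.2.1
            have h1 : ¬ Joined c (· ∈ S) s b a := fun h => hj (h.symm hc)
            have h2 : ¬ Joined c (· ∈ S) s a (ρ b) := fun h => hj (h.trans ((hρ b).symm hc))
            rw [← (hρ a).color_eq hc hb h2, hc.symm, ← (hρ b).color_eq hc hab.1 h1,
              hc.symm, hi']
      intro x hx y hy
      obtain ⟨x', hx', rfl⟩ := Finset.mem_image.1 hx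
      obtain ⟨y', hy', rfl⟩ := Finset.mem_image.1 hy
      exact step x' y' (hins x' hx' y' hy')
    obtain ⟨i₁, i₂, i₃, h1, h2, h3, h12, h13, h23⟩ := Finset.two_lt_card_iff.1 (not_le.1 hcard)
    rw [Finset.mem_compl] at h1 h2 h3
    obtain ⟨m, hm⟩ := hc.not_spanning_three (s := s.image ρ) (i := ![i₁, i₂, i₃])
      (List.nodup_ofFn.1 (by simp [h12, h13, h23])) (by
        by_contra hlt
        refine hS fun x hx y hy => ?_
        have := Finset.card_le_one.1 (by omega : (s.image ρ).card ≤ 1) _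
          (Finset.mem_image_of_mem ρ hx) _ (Finset.mem_image_of_mem ρ hy)
        exact (hρ x).trans (this ▸ (hρ y).symm hc))
    refine hm (hspan _ ?_)
    fin_cases m <;> assumption

end Gallai

/-! ### Gallai colourings without monochromatic `C₈` -/

section Upper

variable {V K : Type*} {c : V → V → K}

theorem exists_fin_embedding {n : ℕ} {s : Finset V} (h : n ≤ s.card) :
    ∃ f : Fin n → V, Function.Injective f ∧ ∀ i, f i ∈ s := by
  obtain ⟨f⟩ := Function.Embedding.nonempty_of_card_le (α := Fin n) (β := s) (by simpa using h)
  exact ⟨fun i => f i, Subtype.val_injective.comp f.injective, fun i => (f i).2⟩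

theorem hasCycle_of_bipartite (hc : IsGallai c) {j : K} {X M : Finset V} (hX : 4 ≤ X.card)
    (hM : 4 ≤ M.card) (hd : Disjoint X M) (h : ∀ x ∈ X, ∀ m ∈ M, c x m = j) :
    HasCycle 8 fun x y => c x y = j := by
  obtain ⟨x, hx, hxX⟩ := exists_fin_embedding hX
  obtain ⟨m, hm, hmM⟩ := exists_fin_embedding hM
  have ne : ∀ i j, x i ≠ m j := fun i j => Finset.disjoint_iff_ne.1 hd _ (hxX i) _ (hmM j)
  have e : ∀ i j, c (x i) (m j) = _ := fun i j => h _ (hxX i) _ (hmM j)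
  refine .of_eight (x 0) (m 0) (x 1) (m 1) (x 2) (m 2) (x 3) (m 3) ?_ (e _ _)
    ((hc.symm _ _).trans (e _ _)) (e _ _) ((hc.symm _ _).trans (e _ _)) (e _ _)
    ((hc.symm _ _).trans (e _ _)) (e _ _) ((hc.symm _ _).trans (e _ _))
  simp [hx.eq_iff, hm.eq_iff, ne, fun i j => (ne j i).symm]

/-- A set `A` of vertices, together with, for each colour `j`, at most three further vertices,
forming the set `X j`, all of whose edges to `A` have colour `j`. All in all there are at least
`3k + 5` vertices, where `k` is the number of colours. -/
structure Cone [Fintype K] (c : V → V → K) (A : Finset V) (X : K → Finset V) : Prop where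
  color : ∀ {j x a}, x ∈ X j → a ∈ A → c x a = j
  notMem : ∀ {j x}, x ∈ X j → x ∉ A
  small : ∀ j, (X j).card ≤ 3
  large : 3 * Fintype.card K + 5 ≤ A.card + ∑ j, (X j).card

namespace Cone

variable [Fintype K] {A : Finset V} {X : K → Finset V}

theorem five_le (h : Cone c A X) : 5 ≤ A.card := by
  have h1 := h.large
  have h2 : ∑ j, (X j).card ≤ 3 * Fintype.card K := by
    refine (Finset.sum_le_card_nsmul _ _ 3 fun j _ => h.small j).trans (le_of_eq ?_)
    rw [Finset.card_univ, smul_eq_mul, mul_comm]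
  omega

/-- If `A` is replaced by a module `M` with at least four vertices, then the vertices of `A \ M`
move to the sets `X j`. These remain small, since `K_{4,4}` contains `C₈`. -/
theorem restrict [DecidableEq V] [DecidableEq K] (h : Cone c A X) (hc : IsGallai c)
    (n8 : ∀ i, ¬ HasCycle 8 fun x y => c x y = i) {M : Finset V} (hMA : M ⊆ A) (hM : 4 ≤ M.card)
    (hmod : ∀ z ∈ A \ M, ∃ j, ∀ m ∈ M, c z m = j) :
    Cone c M fun j => X j ∪ {z ∈ A \ M | ∀ m ∈ M, c z m = j} := by
  have color : ∀ {j x a}, x ∈ X j ∪ {z ∈ A \ M | ∀ m ∈ M, c z m = j} → a ∈ M → c x a = j := by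
    intro j x a hx ha
    rcases Finset.mem_union.1 hx with hx | hx
    · exact h.color hx (hMA ha)
    · exact (Finset.mem_filter.1 hx).2 a ha
  have notMem : ∀ {j x}, x ∈ X j ∪ {z ∈ A \ M | ∀ m ∈ M, c z m = j} → x ∉ M := by
    intro j x hx hxM
    rcases Finset.mem_union.1 hx with hx | hx
    · exact h.notMem hx (hMA hxM)
    · exact (Finset.mem_sdiff.1 (Finset.mem_filter.1 hx).1).2 hxM
  refine ⟨color, notMem, fun j => ?_, ?_⟩
  · by_contra hlt
    exact n8 j (hasCycle_of_bipartite hc (by omega) hM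
      (Finset.disjoint_left.2 fun x hx => notMem hx) fun x hx m hm => color hx hm)
  · have hdis : ∀ j, (X j ∪ {z ∈ A \ M | ∀ m ∈ M, c z m = j}).card =
        (X j).card + ({z ∈ A \ M | ∀ m ∈ M, c z m = j} : Finset V).card := by
      intro j
      refine Finset.card_union_of_disjoint (Finset.disjoint_left.2 fun x hx hx' => ?_)
      exact h.notMem hx (Finset.mem_sdiff.1 (Finset.mem_filter.1 hx').1).1
    have hcover : (A \ M).card ≤
        ∑ j, ({z ∈ A \ M | ∀ m ∈ M, c z m = j} : Finset V).card := by
      refine le_trans (Finset.card_le_card fun z hz => ?_) Finset.card_biUnion_le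
      obtain ⟨j, hj⟩ := hmod z hz
      exact Finset.mem_biUnion.2 ⟨j, Finset.mem_univ _, Finset.mem_filter.2 ⟨hz, hj⟩⟩
    have h1 := h.large
    have h2 := Finset.card_sdiff_add_card_eq_card hMA
    simp only [hdis, Finset.sum_add_distrib]
    omega

theorem card_ne_five (h : Cone c A X) (hc : IsGallai c)
    (n8 : ∀ i, ¬ HasCycle 8 fun x y => c x y = i) : A.card ≠ 5 := by
  intro h5
  have full : ∀ j, (X j).card = 3 := by
    have hle : ∀ j ∈ Finset.univ, (X j).card ≤ 3 := fun j _ => h.small j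
    have hsum : ∑ _j : K, 3 = 3 * Fintype.card K := by simp [mul_comm]
    have h1 := h.large
    have := (Finset.sum_eq_sum_iff_of_le hle).1
      (le_antisymm (Finset.sum_le_sum hle) (by omega))
    exact fun j => this j (Finset.mem_univ _)
  obtain ⟨a, ha, haA⟩ := exists_fin_embedding h5.ge
  -- Three vertices of `A` span a monochromatic path; close it up through `X j`.
  have close : ∀ σ : Fin 5 → Fin 5, Function.Injective σ →
      c (a (σ 0)) (a (σ 1)) = c (a (σ 1)) (a (σ 2)) → False := by
    intro σ hσ hp
    generalize hj : c (a (σ 0)) (a (σ 1)) = j at hp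
    obtain ⟨x, hx, hxX⟩ := exists_fin_embedding (full j).ge
    have ne : ∀ i l, x i ≠ a l := fun i l he => h.notMem (hxX i) (he ▸ haA l)
    have e : ∀ i l, c (x i) (a l) = j := fun i l => h.color (hxX i) (haA l)
    refine n8 j (.of_eight (a (σ 0)) (a (σ 1)) (a (σ 2)) (x 0) (a (σ 3)) (x 1) (a (σ 4)) (x 2) ?_
      hj hp.symm ((hc.symm _ _).trans (e _ _)) (e _ _) ((hc.symm _ _).trans (e _ _)) (e _ _)
      ((hc.symm _ _).trans (e _ _)) (e _ _))
    simp [hx.eq_iff, ha.eq_iff, hσ.eq_iff, ne, fun i j => (ne j i).symm]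
  rcases hc.triangle (x := a 0) (y := a 1) (z := a 2) (ha.ne (by decide)) (ha.ne (by decide))
    (ha.ne (by decide)) with h | h | h
  · exact close id Function.injective_id h
  · exact close ![1, 2, 0, 3, 4] (by decide) (h.trans (hc.symm _ _))
  · exact close ![1, 0, 2, 3, 4] (by decide) ((hc.symm _ _).trans h)

end Cone

/-! ### Reduction to two colours -/

section TwoColors

/-- `x` and `y` are in the same part of the blow-up formed by `A`, `X r` and `X b`, whose parts are
`X r`, `X b`, and the components in `A` of the colours other than `r` and `b`. Only vertices in one
of the three sets matter, so those outside `A` and `X r` stand for `X b`. -/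
def SamePart (c : V → V → K) (A Xr : Finset V) (r b : K) (x y : V) : Prop :=
  (x ∈ A ∧ y ∈ A ∧ Joined c (fun k => k ≠ r ∧ k ≠ b) A x y) ∨
    (x ∉ A ∧ y ∉ A ∧ (x ∈ Xr ↔ y ∈ Xr))

open Classical in
/-- The colouring `c`, with the colour `r` given to all pairs of vertices outside `A`. -/
noncomputable def virtualColor (c : V → V → K) (A : Finset V) (r : K) (x y : V) : K :=
  if x ∉ A ∧ y ∉ A then r else c x y

open Classical in
/-- The two-colouring of the blow-up formed by `A`, `X r` and `X b`, in which `true` stands for `r`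
and `false` for `b`. The pairs between `X r` and `X b`, about whose colours nothing is known, are
coloured `true`. -/
noncomputable def partColor (c : V → V → K) (A Xr : Finset V) (r b : K) (x y : V) : Option Bool :=
  if SamePart c A Xr r b x y then none else some (decide (virtualColor c A r x y = r))

variable {A Xr : Finset V} {r b : K} {x y z : V}

theorem SamePart.refl : SamePart c A Xr r b x x := by
  by_cases h : x ∈ A
  · exact .inl ⟨h, h, .refl⟩
  · exact .inr ⟨h, h, Iff.rfl⟩

theorem SamePart.symm (hc : IsGallai c) (h : SamePart c A Xr r b x y) :
    SamePart c A Xr r b y x := by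
  rcases h with h | h
  · exact .inl ⟨h.2.1, h.1, h.2.2.symm hc⟩
  · exact .inr ⟨h.2.1, h.1, h.2.2.symm⟩

theorem SamePart.trans (h : SamePart c A Xr r b x y) (h' : SamePart c A Xr r b y z) :
    SamePart c A Xr r b x z := by
  rcases h with h | h <;> rcases h' with h' | h'
  · exact .inl ⟨h.1, h'.2.1, h.2.2.trans h'.2.2⟩
  · exact (h'.1 h.2.1).elim
  · exact (h.2.1 h'.1).elim
  · exact .inr ⟨h.1, h'.2.1, h.2.2.trans h'.2.2⟩

theorem virtualColor_symm (hc : IsGallai c) :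
    virtualColor c A r x y = virtualColor c A r y x := by
  classical
  unfold virtualColor
  rw [hc.symm x y]
  exact if_congr and_comm rfl rfl

theorem partColor_eq_none : partColor c A Xr r b x y = none ↔ SamePart c A Xr r b x y := by
  unfold partColor
  split_ifs <;> simp_all

theorem partColor_eq_some {ε : Bool} : partColor c A Xr r b x y = some ε ↔
    ¬ SamePart c A Xr r b x y ∧ (virtualColor c A r x y = r ↔ ε = true) := by
  unfold partColor
  split_ifs with h
  · simp [h]
  · cases ε <;> simp [h]

end TwoColors

namespace Cone

variable [Fintype K] {A : Finset V} {X : K → Finset V} {r b : K}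

theorem virtualColor_eq [DecidableEq V] (h : Cone c A X) (hc : IsGallai c) {x y z : V}
    (hx : x ∈ A ∪ (X r ∪ X b)) (hy : y ∈ A ∪ (X r ∪ X b)) (hz : z ∈ A ∪ (X r ∪ X b))
    (hxy : SamePart c A (X r) r b x y) (hxz : ¬ SamePart c A (X r) r b x z) :
    virtualColor c A r x z = virtualColor c A r y z := by
  have out : ∀ {x}, x ∈ A ∪ (X r ∪ X b) → x ∉ A → x ∉ X r → x ∈ X b := by
    intro x hx hA hr
    simp only [Finset.mem_union] at hx
    tauto
  unfold virtualColor
  rcases hxy with ⟨hxA, hyA, hxy⟩ | ⟨hxA, hyA, hxy⟩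
  · simp only [hxA, hyA, not_true, false_and, if_false]
    by_cases hzA : z ∈ A
    · exact hxy.color_eq hc hzA fun h => hxz (.inl ⟨hxA, hzA, h⟩)
    · rw [hc.symm x, hc.symm y]
      by_cases hzr : z ∈ X r
      · rw [h.color hzr hxA, h.color hzr hyA]
      · have hzb := out hz hzA hzr
        rw [h.color hzb hxA, h.color hzb hyA]
  · by_cases hzA : z ∈ A
    · simp only [hzA, not_true, and_false, if_false]
      by_cases hxr : x ∈ X r
      · rw [h.color hxr hzA, h.color (hxy.1 hxr) hzA]
      · rw [h.color (out hx hxA hxr) hzA, h.color (out hy hyA fun h => hxr (hxy.2 h)) hzA]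
    · simp [hxA, hyA, hzA]

theorem isBlowup [DecidableEq V] (h : Cone c A X) (hc : IsGallai c)
    (hcomp : ∀ x ∈ A, ∀ M ⊆ A, (∀ y ∈ M, Joined c (fun k => k ≠ r ∧ k ≠ b) A x y) → M.card ≤ 3)
    {e : Fin 11 → V} (he : Function.Injective e) (heS : ∀ i, e i ∈ A ∪ (X r ∪ X b)) :
    IsBlowup fun i j => partColor c A (X r) r b (e i) (e j) where
  symm i j := by
    classical
    unfold partColor
    rw [virtualColor_symm hc]
    exact if_congr ⟨fun h => h.symm hc, fun h => h.symm hc⟩ rfl rfl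
  diag i := partColor_eq_none.2 .refl
  twin := by
    intro i j hij l
    rw [partColor_eq_none] at hij
    unfold partColor
    by_cases hil : SamePart c A (X r) r b (e i) (e l)
    · rw [if_pos hil, if_pos ((hij.symm hc).trans hil)]
    · rw [if_neg hil, if_neg fun h => hil (hij.trans h),
        h.virtualColor_eq hc (heS i) (heS j) (heS l) hij hil]
  small := by
    intro i j l m hnd hij hil him
    rw [partColor_eq_none] at hij hil him
    have hcard : ({e i, e j, e l, e m} : Finset V).card = 4 := by
      have := List.toFinset_card_of_nodup (hnd.map he)
      simpa using this
    by_cases hiA : e i ∈ A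
    · have aux : ∀ {j}, SamePart c A (X r) r b (e i) (e j) →
          e j ∈ A ∧ Joined c (fun k => k ≠ r ∧ k ≠ b) A (e i) (e j) := by
        rintro j (h | h)
        · exact h.2
        · exact (h.1 hiA).elim
      have := hcomp (e i) hiA {e i, e j, e l, e m} (by
        intro x hx
        simp only [Finset.mem_insert, Finset.mem_singleton] at hx
        rcases hx with rfl | rfl | rfl | rfl
        exacts [hiA, (aux hij).1, (aux hil).1, (aux him).1]) (by
        intro x hx
        simp only [Finset.mem_insert, Finset.mem_singleton] at hx
        rcases hx with rfl | rfl | rfl | rfl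
        exacts [.refl, (aux hij).2, (aux hil).2, (aux him).2])
      omega
    · obtain ⟨j', hj'⟩ : ∃ j', ∀ j, SamePart c A (X r) r b (e i) (e j) → e j ∈ X j' := by
        by_cases hir : e i ∈ X r
        · refine ⟨r, fun j hj => ?_⟩
          rcases hj with h | h
          · exact (hiA h.1).elim
          · exact h.2.2.1 hir
        · refine ⟨b, fun j hj => ?_⟩
          have := heS j
          simp only [Finset.mem_union] at this
          rcases hj with h | h
          · exact (hiA h.1).elim
          · tauto
      have : ({e i, e j, e l, e m} : Finset V) ⊆ X j' := by
        intro x hx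
        simp only [Finset.mem_insert, Finset.mem_singleton] at hx
        rcases hx with rfl | rfl | rfl | rfl
        exacts [hj' _ .refl, hj' _ hij, hj' _ hil, hj' _ him]
      have := (Finset.card_le_card this).trans (h.small j')
      omega

/-- A monochromatic `C₈` of the blow-up formed by `A`, `X r` and `X b` gives one of the original
colouring. -/
theorem false_of_octagon [DecidableEq V] (h : Cone c A X) (hc : IsGallai c)
    (n8 : ∀ i, ¬ HasCycle 8 fun x y => c x y = i) (h6 : 6 ≤ A.card) (hrb : r ≠ b) {ε : Bool}
    {f : Fin 8 → V} (hf : Function.Injective f) (hfS : ∀ i, f i ∈ A ∪ (X r ∪ X b))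
    (hcol : ∀ i, partColor c A (X r) r b (f i) (f (i + 1)) = some ε) : False := by
  simp only [partColor_eq_some] at hcol
  cases ε
  · -- Edges coloured `false` have at least one end in `A`.
    refine n8 b ⟨f, hf, fun i => ?_⟩
    obtain ⟨hp, hv⟩ := hcol i
    replace hv : ¬ virtualColor c A r (f i) (f (i + 1)) = r := by simpa using hv
    change c (f i) (f (i + 1)) = b
    unfold virtualColor at hv
    split_ifs at hv with hA
    · exact (hv rfl).elim
    have hi := hfS i
    have hi' := hfS (i + 1)
    simp only [Finset.mem_union] at hi hi'
    by_cases hiA : f i ∈ A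
    · by_cases hiA' : f (i + 1) ∈ A
      · by_contra hb
        exact hp (.inl ⟨hiA, hiA', .single hiA hiA' ⟨hv, hb⟩⟩)
      · rw [hc.symm] at hv ⊢
        rcases hi' with h' | h' | h'
        · exact (hiA' h').elim
        · exact (hv (h.color h' hiA)).elim
        · exact h.color h' hiA
    · have hiA' : f (i + 1) ∈ A := by tauto
      rcases hi with h' | h' | h'
      · exact (hiA h').elim
      · exact (hv (h.color h' hiA')).elim
      · exact h.color h' hiA'
  · -- In a cycle coloured `true`, the neighbours of a vertex of `X b` lie in `X r`. So the vertices
    -- of `X b` can be replaced by unused vertices of `A`.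
    have hv : ∀ i, virtualColor c A r (f i) (f (i + 1)) = r := fun i => by simpa using (hcol i).2
    have hnA : ∀ i, f i ∈ X b → f i ∉ A := fun i => h.notMem
    have cross : ∀ x y, virtualColor c A r x y = r → ¬ SamePart c A (X r) r b x y →
        y ∈ A ∪ (X r ∪ X b) → x ∈ X b → y ∈ X r := by
      intro x y hxy hp hy hx
      have hxA := h.notMem hx
      unfold virtualColor at hxy
      split_ifs at hxy with hA
      · simp only [Finset.mem_union] at hy
        by_contra hyr
        have hyb : y ∈ X b := by tauto
        obtain ⟨a, ha⟩ : A.Nonempty := Finset.card_pos.1 (by omega)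
        exact hp (.inr ⟨hxA, hA.2, fun hxr =>
          (hrb ((h.color hxr ha).symm.trans (h.color hx ha))).elim, fun h => (hyr h).elim⟩)
      · have hyA : y ∈ A := by tauto
        exact (hrb (hxy.symm.trans (h.color hx hyA))).elim
    have next : ∀ i, f i ∈ X b → f (i + 1) ∈ X r := fun i hi =>
      cross _ _ (hv i) (hcol i).1 (hfS _) hi
    have prev : ∀ i, f (i + 1) ∈ X b → f i ∈ X r := fun i hi =>
      cross _ _ ((virtualColor_symm hc).trans (hv i)) (fun h => (hcol i).1 (h.symm hc)) (hfS _) hi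
    have edge : ∀ i, f i ∉ X b → f (i + 1) ∉ X b → c (f i) (f (i + 1)) = r := by
      intro i hi hi'
      have hvi := hv i
      unfold virtualColor at hvi
      split_ifs at hvi with hA
      · have h1 := hfS i
        have h2 := hfS (i + 1)
        simp only [Finset.mem_union] at h1 h2
        exact ((hcol i).1 (.inr ⟨hA.1, hA.2, by tauto⟩)).elim
      · exact hvi
    have hcard : Fintype.card {i // f i ∈ X b} ≤ Fintype.card ↥(A \ Finset.univ.image f) := by
      rw [Fintype.card_subtype, Fintype.card_coe]
      by_cases hex : ∃ i, f (i + 1) ∈ X b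
      · obtain ⟨i, hi⟩ := hex
        have h2 : 2 ≤ (Finset.univ.filter fun i => f i ∈ X r).card :=
          Finset.one_lt_card.2 ⟨i, by simpa using prev i hi, i + 1 + 1, by simpa using next _ hi,
            by clear * -; revert i; decide⟩
        have h3 : (Finset.univ.filter fun i => f i ∈ A).card = (A ∩ Finset.univ.image f).card := by
          rw [← Finset.card_image_of_injective _ hf]
          congr 1
          ext x
          simp only [Finset.mem_image, Finset.mem_filter, Finset.mem_univ, true_and,
            Finset.mem_inter]
          constructor
          · rintro ⟨i, hi, rfl⟩
            exact ⟨hi, i, rfl⟩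
          · rintro ⟨hx, i, rfl⟩
            exact ⟨i, hx, rfl⟩
        have h4 : (Finset.univ.filter fun i => f i ∈ A).card +
            ((Finset.univ.filter fun i => f i ∈ X r).card +
              (Finset.univ.filter fun i => f i ∈ X b).card) ≤ 8 := by
          rw [← Finset.card_union_of_disjoint, ← Finset.card_union_of_disjoint]
          · exact (Finset.card_le_univ _).trans (by simp)
          · refine Finset.disjoint_left.2 fun i hi hi' => ?_
            simp only [Finset.mem_union, Finset.mem_filter, Finset.mem_univ, true_and] at hi hi'
            exact hi'.elim (fun h' => h.notMem h' hi) (fun h' => h.notMem h' hi)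
          · refine Finset.disjoint_left.2 fun i hi hi' => ?_
            simp only [Finset.mem_filter, Finset.mem_univ, true_and] at hi hi'
            obtain ⟨a, ha⟩ : A.Nonempty := Finset.card_pos.1 (by omega)
            exact hrb ((h.color hi ha).symm.trans (h.color hi' ha))
        have h5 := Finset.card_sdiff_add_card_inter A (Finset.univ.image f)
        omega
      · have : (Finset.univ.filter fun i => f i ∈ X b) = ∅ := by
          refine Finset.filter_eq_empty_iff.2 fun i _ hi => hex ⟨i - 1, ?_⟩
          rwa [sub_add_cancel]
        rw [this]
        exact Nat.zero_le _
    obtain ⟨φ⟩ := Function.Embedding.nonempty_of_card_le hcard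
    have hφA : ∀ i, (φ i : V) ∈ A := fun i => (Finset.mem_sdiff.1 (φ i).2).1
    have hφf : ∀ i j, (φ i : V) ≠ f j := fun i j he =>
      (Finset.mem_sdiff.1 (φ i).2).2 (Finset.mem_image.2 ⟨j, Finset.mem_univ _, he.symm⟩)
    refine n8 r ⟨fun i => if hi : f i ∈ X b then φ ⟨i, hi⟩ else f i, fun i j hij => ?_, fun i => ?_⟩
    · dsimp only at hij
      split_ifs at hij with hi hj hj
      · exact congrArg Subtype.val (φ.injective (Subtype.ext hij))
      · exact (hφf _ _ hij).elim
      · exact (hφf _ _ hij.symm).elim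
      · exact hf hij
    · dsimp only
      split_ifs with hi hj hj
      · exact (hnA _ hj).elim (by
          obtain ⟨a, ha⟩ : A.Nonempty := Finset.card_pos.1 (by omega)
          exact (hrb ((h.color (next i hi) ha).symm.trans (h.color hj ha))).elim)
      · rw [hc.symm]
        exact h.color (next i hi) (hφA _)
      · exact h.color (prev i hj) (hφA _)
      · exact edge i hi hj

/-- A minimal counterexample `A` has no proper module with at least four vertices, so that `A`,
`X r` and `X b` form a blow-up for the two colours `r` and `b` provided by Gallai's theorem. It has
at least eleven vertices, as each of the other sets `X j` takes away at most three. -/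
theorem false_of_two_le [DecidableEq V] [DecidableEq K] (h : Cone c A X) (hc : IsGallai c)
    (hK : 2 ≤ Fintype.card K) (n8 : ∀ i, ¬ HasCycle 8 fun x y => c x y = i) : False := by
  induction hn : A.card using Nat.strong_induction_on generalizing A X with
  | _ n ih =>
  have h6 : 6 ≤ A.card := lt_of_le_of_ne h.five_le (h.card_ne_five hc n8).symm
  obtain ⟨r, b, hrb, hns⟩ := hc.exists_not_spanning (s := A) (by omega) hK
  have hcomp : ∀ x ∈ A, ∀ M ⊆ A,
      (∀ y ∈ M, Joined c (fun k => k ≠ r ∧ k ≠ b) A x y) → M.card ≤ 3 := by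
    classical
    intro x hx M hMA hM
    by_contra hlt
    let C : Finset V := {y ∈ A | Joined c (fun k => k ≠ r ∧ k ≠ b) A x y}
    have hMC : M ⊆ C := fun y hy => Finset.mem_filter.2 ⟨hMA hy, hM y hy⟩
    have hCA : C ⊂ A := by
      refine (Finset.filter_subset _ _).ssubset_of_ne fun (hCA : C = A) => hns fun y hy z hz => ?_
      have hy' : y ∈ C := hCA ▸ hy
      have hz' : z ∈ C := hCA ▸ hz
      exact ((Finset.mem_filter.1 hy').2.symm hc).trans (Finset.mem_filter.1 hz').2
    have := Finset.card_le_card hMC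
    refine ih _ ?_ (h.restrict hc n8 hCA.subset (by omega) ?_) rfl
    · rw [← hn]
      exact Finset.card_lt_card hCA
    · intro z hz
      obtain ⟨hzA, hzC⟩ := Finset.mem_sdiff.1 hz
      refine ⟨c x z, fun m hm => ?_⟩
      rw [hc.symm]
      exact ((Finset.mem_filter.1 hm).2.color_eq hc hzA fun h =>
        hzC (Finset.mem_filter.2 ⟨hzA, h⟩)).symm
  have hcard : 11 ≤ (A ∪ (X r ∪ X b)).card := by
    obtain ⟨a, ha⟩ : A.Nonempty := Finset.card_pos.1 (by omega)
    have d1 : Disjoint (X r) (X b) := Finset.disjoint_left.2 fun x hx hx' =>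
      hrb ((h.color hx ha).symm.trans (h.color hx' ha))
    have d2 : Disjoint A (X r ∪ X b) := Finset.disjoint_left.2 fun x hx hx' =>
      (Finset.mem_union.1 hx').elim (fun h' => h.notMem h' hx) (fun h' => h.notMem h' hx)
    rw [Finset.card_union_of_disjoint d2, Finset.card_union_of_disjoint d1]
    have h1 := h.large
    have h2 := Finset.sum_le_card_nsmul ((Finset.univ.erase r).erase b) (fun j => (X j).card) 3
      fun j _ => h.small j
    have hb : b ∈ Finset.univ.erase r := Finset.mem_erase.2 ⟨hrb.symm, Finset.mem_univ _⟩
    rw [Finset.card_erase_of_mem hb, Finset.card_erase_of_mem (Finset.mem_univ _),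
      Finset.card_univ, smul_eq_mul] at h2
    have h3 := Finset.add_sum_erase _ (fun j => (X j).card) (Finset.mem_univ r)
    have h4 := Finset.add_sum_erase _ (fun j => (X j).card) hb
    omega
  obtain ⟨e, he, heS⟩ := exists_fin_embedding hcard
  have hno := (h.isBlowup hc hcomp he heS).not_noOctagon
  simp only [NoOctagon, not_forall, not_not] at hno
  obtain ⟨ε, f, hf, hcol⟩ := hno
  exact h.false_of_octagon hc n8 h6 hrb (he.comp hf) (fun i => heS _) hcol

end Cone

theorem IsGallai.hasCycle_eight [Fintype V] [Fintype K] (hc : IsGallai c)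
    (hK : 1 ≤ Fintype.card K) (hV : 3 * Fintype.card K + 5 ≤ Fintype.card V) :
    ∃ i, HasCycle 8 fun x y => c x y = i := by
  obtain h1 | h2 := hK.eq_or_lt
  · obtain ⟨i, hi⟩ := Fintype.card_eq_one_iff.1 h1.symm
    obtain ⟨f, hf, -⟩ := exists_fin_embedding (n := 8) (s := (Finset.univ : Finset V))
      (by rw [Finset.card_univ]; omega)
    exact ⟨i, f, hf, fun _ => hi _⟩
  · by_contra! n8
    classical
    refine Cone.false_of_two_le (c := c) (A := Finset.univ) (X := fun _ => ∅)
      ⟨?_, ?_, ?_, ?_⟩ hc h2 n8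
    · simp
    · simp
    · simp
    · simpa using hV

end Upper

/-! ### Edge labelings as functions of two vertices -/

section Labeling

variable {V K : Type*}

open Classical in
/-- The edge labeling `c` as a function of two vertices, with the value `d` on the diagonal. -/
noncomputable def labelFun (c : SimpleGraph.TopEdgeLabeling V K) (d : K) (x y : V) : K :=
  if h : x ≠ y then c.get x y h else d

theorem labelFun_of_ne (c : SimpleGraph.TopEdgeLabeling V K) (d : K) {x y : V} (h : x ≠ y) :
    labelFun c d x y = c.get x y h := dif_pos h

theorem labelFun_symm (c : SimpleGraph.TopEdgeLabeling V K) (d : K) (x y : V) :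
    labelFun c d x y = labelFun c d y x := by
  obtain rfl | h := eq_or_ne x y
  · rfl
  · rw [labelFun_of_ne c d h, labelFun_of_ne c d h.symm, SimpleGraph.EdgeLabeling.get_comm]

theorem hasRainbowCopy_triangle_iff (c : SimpleGraph.TopEdgeLabeling V K) (d : K) :
    HasRainbowCopy c (SimpleGraph.completeGraph (Fin 3)) ↔
      ∃ f : Fin 3 → V, Function.Injective f ∧
        labelFun c d (f 0) (f 1) ≠ labelFun c d (f 1) (f 2) ∧
        labelFun c d (f 1) (f 2) ≠ labelFun c d (f 0) (f 2) ∧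
        labelFun c d (f 0) (f 1) ≠ labelFun c d (f 0) (f 2) := by
  constructor
  · rintro ⟨f, hf⟩
    have key : ∀ a b a' b' : Fin 3, a ≠ b → a' ≠ b' → s(a, b) ≠ s(a', b') →
        labelFun c d (f a) (f b) ≠ labelFun c d (f a') (f b') := by
      intro a b a' b' hab hab' hne heq
      have hab1 : f a ≠ f b := f.injective.ne hab
      have hab2 : f a' ≠ f b' := f.injective.ne hab'
      rw [labelFun_of_ne c d hab1, labelFun_of_ne c d hab2] at heq
      exact hne (congrArg Subtype.val (hf (a₁ := ⟨s(a, b), hab⟩) (a₂ := ⟨s(a', b'), hab'⟩) heq))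
    exact ⟨f, f.injective, key 0 1 1 2 (by decide) (by decide) (by decide),
      key 1 2 0 2 (by decide) (by decide) (by decide),
      key 0 1 0 2 (by decide) (by decide) (by decide)⟩
  · rintro ⟨f, hf, h1, h2, h3⟩
    refine ⟨⟨⟨f, fun h => hf.ne h⟩, hf⟩, ?_⟩
    rintro ⟨e, he⟩ ⟨e', he'⟩ heq
    refine Subtype.ext ?_
    induction e using Sym2.inductionOn with | _ a b
    induction e' using Sym2.inductionOn with | _ a' b'
    have hab : a ≠ b := he
    have hab' : a' ≠ b' := he'
    replace heq : c.get (f a) (f b) (hf.ne hab) = c.get (f a') (f b') (hf.ne hab') := heq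
    rw [← labelFun_of_ne c d, ← labelFun_of_ne c d] at heq
    have s := labelFun_symm c d
    have s10 := s (f 1) (f 0)
    have s21 := s (f 2) (f 1)
    have s20 := s (f 2) (f 0)
    change s(a, b) = s(a', b')
    clear he he' s
    fin_cases a <;> fin_cases b <;> first | exact absurd rfl hab | skip
    all_goals
      fin_cases a' <;> fin_cases b' <;>
        first | exact absurd rfl hab' | rfl | exact Sym2.eq_swap | exfalso
    all_goals
      simp only [Fin.zero_eta, Fin.mk_one, Fin.reduceFinMk, s10, s21, s20] at heq
      first
        | exact h1 heq | exact h2 heq | exact h3 heq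
        | exact h1 heq.symm | exact h2 heq.symm | exact h3 heq.symm

theorem hasMonochromaticCopy_cycleGraph_iff (c : SimpleGraph.TopEdgeLabeling V K) (d : K) :
    HasMonochromaticCopy c (SimpleGraph.cycleGraph 8) ↔
      ∃ i, HasCycle 8 fun x y => labelFun c d x y = i := by
  constructor
  · rintro ⟨f, i, hf⟩
    refine ⟨i, f, f.injective, fun j => ?_⟩
    have hadj : (SimpleGraph.cycleGraph 8).Adj j (j + 1) := by
      rw [SimpleGraph.cycleGraph_adj]
      exact .inr (add_sub_cancel_left j 1)
    have hne : f j ≠ f (j + 1) := f.injective.ne hadj.ne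
    refine (labelFun_of_ne c d hne).trans ?_
    exact hf ⟨s(j, j + 1), hadj⟩
  · rintro ⟨i, f, hf, hc⟩
    have hc' : ∀ a b, (SimpleGraph.cycleGraph 8).Adj a b → labelFun c d (f a) (f b) = i := by
      intro a b hab
      rw [SimpleGraph.cycleGraph_adj] at hab
      rcases hab with h | h
      · rw [labelFun_symm, ← hc b, ← h, add_sub_cancel]
      · rw [← hc a, ← h, add_sub_cancel]
    refine ⟨⟨⟨f, fun h => hf.ne h.ne⟩, hf⟩, i, ?_⟩
    rintro ⟨e, he⟩
    induction e using Sym2.inductionOn with | _ a b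
    have hab : (SimpleGraph.cycleGraph 8).Adj a b := he
    have := hc' a b hab
    rwa [labelFun_of_ne c d (hf.ne hab.ne)] at this

end Labeling

/-! ### The bounds -/

theorem forces_of_le {k n : ℕ} (hk : 1 ≤ k) (hn : 3 * k + 5 ≤ n) :
    Forces k (SimpleGraph.completeGraph (Fin 3)) (SimpleGraph.cycleGraph 8) n := by
  intro c
  let d : Fin k := ⟨0, hk⟩
  rw [hasRainbowCopy_triangle_iff c d, hasMonochromaticCopy_cycleGraph_iff c d]
  refine or_iff_not_imp_left.2 fun hno => ?_
  have hc : IsGallai (labelFun c d) := by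
    refine ⟨labelFun_symm c d, fun {x y z} hxy hyz hxz => ?_⟩
    by_contra! hcon
    exact hno ⟨![x, y, z], List.nodup_ofFn.1 (by simp [hxy, hyz, hxz]), hcon⟩
  exact hc.hasCycle_eight (by simpa using hk) (by simpa using hn)

/-- The colour of the pairs with larger element `m` in the extremal colouring: colour `0` inside the
first seven vertices, and a new colour for each further group of three vertices. -/
def layer (m : ℕ) : ℕ := if m < 7 then 0 else (m - 7) / 3 + 1

theorem layer_lt {k m : ℕ} (hk : 1 ≤ k) (hm : m < 3 * k + 4) : layer m < k := by
  unfold layer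
  split_ifs <;> omega

/-- Colour `0` of the extremal colouring lives on seven vertices. The edges in any other colour are
covered by the three vertices of its layer, whereas a vertex cover of `C₈` has four elements. -/
theorem not_forces_of_lt {k n : ℕ} (hk : 1 ≤ k) (hn : n < 3 * k + 5) :
    ¬ Forces k (SimpleGraph.completeGraph (Fin 3)) (SimpleGraph.cycleGraph 8) n := by
  intro hF
  let c : SimpleGraph.TopEdgeLabeling (Fin n) (Fin k) := SimpleGraph.EdgeLabeling.mk
    (fun x y _ => ⟨layer (max x.val y.val), layer_lt hk (by omega)⟩)
    (fun x y _ => by simp only [max_comm])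
  have hval : ∀ d x y, x ≠ y → (labelFun c d x y).val = layer (max x.val y.val) := by
    intro d x y h
    rw [labelFun_of_ne c d h]
    rfl
  let d : Fin k := ⟨0, hk⟩
  rcases hF c with h | h
  · obtain ⟨f, hf, h1, h2, h3⟩ := (hasRainbowCopy_triangle_iff c d).1 h
    rw [Ne, Fin.ext_iff, hval d _ _ (hf.ne (by decide)), hval d _ _ (hf.ne (by decide))]
      at h1 h2 h3
    generalize (f 0).val = x at *
    generalize (f 1).val = y at *
    generalize (f 2).val = z at *
    have : max x y = max y z ∨ max y z = max x z ∨ max x y = max x z := by omega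
    rcases this with h | h | h
    · exact h1 (congrArg layer h)
    · exact h2 (congrArg layer h)
    · exact h3 (congrArg layer h)
  · obtain ⟨i, f, hf, hcyc⟩ := (hasMonochromaticCopy_cycleGraph_iff c d).1 h
    have hl : ∀ j : Fin 8, layer (max (f j).val (f (j + 1)).val) = i.val := fun j => by
      rw [← hcyc j, hval d _ _ (hf.ne (by revert j; decide))]
    have hinj : ∀ {a b : Fin 8}, a ≠ b → (f a).val ≠ (f b).val := fun hab h =>
      hab (hf (Fin.ext h))
    by_cases hi : i.val = 0
    · have h7 : ∀ j, (f j).val < 7 := by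
        intro j
        have := hl j
        rw [hi] at this
        unfold layer at this
        split_ifs at this with h
        omega
      have := Fintype.card_le_of_injective (fun j => (⟨f j, h7 j⟩ : Fin 7)) fun a b hab =>
        hf (Fin.ext (by simpa using hab))
      simp at this
    · have hm : ∀ j : Fin 8, 3 * i.val + 4 ≤ max (f j).val (f (j + 1)).val ∧
          max (f j).val (f (j + 1)).val ≤ 3 * i.val + 6 := by
        intro j
        have := hl j
        unfold layer at this
        split_ifs at this <;> omega
      -- Among the larger ends of four disjoint edges of the cycle, two coincide.
      have ne : ∀ a b : Fin 8, a ≠ b → a ≠ b + 1 → a + 1 ≠ b → a + 1 ≠ b + 1 →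
          max (f a).val (f (a + 1)).val ≠ max (f b).val (f (b + 1)).val := by
        intro a b h1 h2 h3 h4
        have := hinj h1
        have := hinj h2
        have := hinj h3
        have := hinj h4
        omega
      have m0 := hm 0
      have m2 := hm 2
      have m4 := hm 4
      have m6 := hm 6
      have n02 := ne 0 2 (by decide) (by decide) (by decide) (by decide)
      have n04 := ne 0 4 (by decide) (by decide) (by decide) (by decide)
      have n06 := ne 0 6 (by decide) (by decide) (by decide) (by decide)
      have n24 := ne 2 4 (by decide) (by decide) (by decide) (by decide)
      have n26 := ne 2 6 (by decide) (by decide) (by decide) (by decide)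
      have n46 := ne 4 6 (by decide) (by decide) (by decide) (by decide)
      generalize max (f 0).val (f (0 + 1)).val = a at *
      generalize max (f 2).val (f (2 + 1)).val = b at *
      generalize max (f 4).val (f (4 + 1)).val = e at *
      generalize max (f 6).val (f (6 + 1)).val = g at *
      omega

end GallaiRamsey

theorem theorem1 (k : ℕ) (hk : 1 ≤ k) :
    GallaiRamsey.IsGallaiRamseyNumber k (SimpleGraph.completeGraph (Fin 3))
        (SimpleGraph.cycleGraph 8) (3 * k + 5) ∧
      ∀ n : ℕ, 3 * k + 5 ≤ n →
        GallaiRamsey.Forces k (SimpleGraph.completeGraph (Fin 3)) (SimpleGraph.cycleGraph 8) n :=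
  ⟨⟨GallaiRamsey.forces_of_le hk le_rfl, fun _ hn => not_lt.1 fun hlt =>
    GallaiRamsey.not_forces_of_lt hk hlt hn⟩, fun _ hn => GallaiRamsey.forces_of_le hk hn⟩
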